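/- For each $d\ge 1$ let $D_d\subset\mathbb R^d$, and assume that either $D_d=(0,1)^d$ for all $d$, or all $D_d$ are open convex sets of Lebesgue measure $1$ with small radius, i.e. $$\limsup_{d\to\infty}\frac{\mathrm{rad}(D_d)}{\sqrt d}<\sqrt{\frac{2}{\pi\mathrm e}},\qquad \mathrm{rad}(D_d)=\inf_{x\in\mathbb R^d}\sup_{y\in D_d}\|y-x\|_2 .$$ Let $k\in\mathbb N=\{1,2,\dots\}$, let $L_{j,d}>0$ for $0\le j\le k$ and $d\ge1$, and let $$\widetilde C_d^k(L)=\Bigl\{f\in C^k(D_d):\ \|f\|_\infty\le 1,\ \sup_{|\beta|=j}\mathrm{Lip}(D^\beta f)\le L_{j,d}\ \text{ for all } 0\le j\le k\Bigr\},$$ where $\mathrm{Lip}$ is the Lipschitz constant on $D_d$ with respect to the Euclidean norm. For a class $F_d$ of functions on $D_d$, let $n(\varepsilon,F_d)$ be the minimal number $n$ for which there is an algorithm $A(f)=\phi(f(x_1),\dots,f(x_n))$ with $\phi:\mathbb R^n\to\mathbb R$ arbitrary and points $x_i\in D_d$, where $x_i$ may depend on $f(x_1),\dots,f(x_{i-1})$,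 such that $\sup_{f\in F_d}\bigl|\int_{D_d}f(x)\,\mathrm dx-A(f)\bigr|\le\varepsilon$. The curse of dimensionality holds for $(F_d)$ if there are $c,\varepsilon_0,\gamma>0$ such that $n(\varepsilon,F_d)\ge c(1+\gamma)^d$ for all $0<\varepsilon\le\varepsilon_0$ and infinitely many $d$. (i) If the conditions $L_{0,d}\sqrt d\not\to0$ and $L_{j,d}\,d\not\to0$, $j=1,\dots,k$, hold jointly along a common subsequence of dimensions, i.e. if $$\limsup_{d\to\infty}\ \min\Bigl\{L_{0,d}\sqrt d,\ \min_{1\le j\le k}L_{j,d}\,d\Bigr\}>0,$$ then the curse of dimensionality holds for $\widetilde C_d^k(L)$. (ii) If $\lim_{d\to\infty}L_{j,d}\,d^{\,j+1/2}=0$ for some $j\in\{0,1,\dots,k\}$, then the curse of dimensionality does not hold for $\widetilde C_d^k(L)$. -/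

import Mathlib

open Filter Topology MeasureTheory Set
open scoped ENNReal

noncomputable section

namespace CurseIntegration

/-- `ℝ^d` with the Euclidean norm and Lebesgue measure. -/
abbrev E (d : ℕ) : Type := EuclideanSpace ℝ (Fin d)

/-! ### Algorithms and information complexity -/

/-- An adaptive algorithm using function values at points of `D`. The next sample point depends
on the list of values computed so far (hence also on how many values were computed), and the
output is an arbitrary function of the list of all computed values. -/
structure Algorithm {d : ℕ} (D : Set (E d)) where
  node : List ℝ → E d
  node_mem : ∀ v, node v ∈ D
  output : List ℝ → ℝ

/-- The list of the first `n` function values computed when the algorithm is applied to `f`. -/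
def Algorithm.values {d : ℕ} {D : Set (E d)} (A : Algorithm D) (f : E d → ℝ) : ℕ → List ℝ
  | 0 => []
  | n + 1 => A.values f n ++ [f (A.node (A.values f n))]

/-- The output of the algorithm after `n` function values. -/
def Algorithm.run {d : ℕ} {D : Set (E d)} (A : Algorithm D) (n : ℕ) (f : E d → ℝ) : ℝ :=
  A.output (A.values f n)

/-- The algorithm that stops after `n` function values has worst case error at most `ε` for the
integration over `D` of the functions in `F`. -/
def Algorithm.ErrorLE {d : ℕ} {D : Set (E d)} (A : Algorithm D) (n : ℕ)
    (F : Set (E d → ℝ)) (ε : ℝ) : Prop :=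
  ∀ f ∈ F, |(∫ x in D, f x) - A.run n f| ≤ ε

/-- The information complexity `n(ε, F)`: the minimal number of function values which is needed
to guarantee a worst case error at most `ε` (`⊤` if no number suffices). -/
def infoComplexity {d : ℕ} (D : Set (E d)) (F : Set (E d → ℝ)) (ε : ℝ) : ℕ∞ :=
  ⨅ n ∈ {n : ℕ | ∃ A : Algorithm D, A.ErrorLE n F ε}, (n : ℕ∞)

/-- The curse of dimensionality: there are positive `c`, `ε₀`, `γ` such that
`n(ε, F_d) ≥ c (1 + γ)^d` for all `0 < ε ≤ ε₀` and infinitely many `d`. -/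
def CurseOfDimensionality (D : ∀ d : ℕ, Set (E d)) (F : ∀ d : ℕ, Set (E d → ℝ)) : Prop :=
  ∃ c ε₀ γ : ℝ, 0 < c ∧ 0 < ε₀ ∧ 0 < γ ∧ ∀ ε : ℝ, 0 < ε → ε ≤ ε₀ →
    ∃ᶠ d : ℕ in atTop,
      ENNReal.ofReal (c * (1 + γ) ^ d) ≤ ((infoComplexity (D d) (F d) ε : ℕ∞) : ℝ≥0∞)

/-! ### Domains -/

/-- The open unit cube `(0,1)^d`. -/
def openCube (d : ℕ) : Set (E d) := {x | ∀ i, x i ∈ Ioo (0 : ℝ) 1}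

/-- The radius `inf_x sup_{y ∈ D} ‖y - x‖₂`, infinite for unbounded sets. -/
def rad {d : ℕ} (D : Set (E d)) : ℝ≥0∞ := ⨅ x : E d, ⨆ y ∈ D, edist y x

/-- Open convex sets of volume one with small radius:
`limsup rad(D_d)/√d < √(2/(π e))`. -/
structure ConvexSmallRadius (D : ∀ d : ℕ, Set (E d)) : Prop where
  isOpen : ∀ d, 1 ≤ d → IsOpen (D d)
  convex : ∀ d, 1 ≤ d → Convex ℝ (D d)
  volume_eq_one : ∀ d, 1 ≤ d → volume (D d) = 1
  limsup_rad_lt :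
    limsup (fun d : ℕ => rad (D d) / ENNReal.ofReal (Real.sqrt d)) atTop
      < ENNReal.ofReal (Real.sqrt (2 / (Real.pi * Real.exp 1)))

/-! ### Function classes -/

/-- The partial derivative `∂^j f / ∂x_{i₁} ⋯ ∂x_{i_j}` at `x`, for `i : Fin j → Fin d`. Where `f`
is `j` times continuously differentiable the order of the indices is irrelevant, and these are
exactly the derivatives `D^β f` with `|β| = j`, `β_m` being the number of indices equal to `m`. -/
def partialDeriv {d : ℕ} (j : ℕ) (i : Fin j → Fin d) (f : E d → ℝ) (x : E d) : ℝ :=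
  iteratedFDeriv ℝ j f x (fun m => EuclideanSpace.single (i m) (1 : ℝ))

/-- The class of `f ∈ C^k(D)` with `‖f‖_∞ ≤ 1` on `D` and `Lip(D^β f) ≤ L_j` on `D` for all
multi-indices with `|β| = j` and all `j ≤ k`. Functions are defined on the whole space, but only
their values on the open set `D` matter, here and for the algorithms and integrals above. -/
def partialClass {d : ℕ} (D : Set (E d)) (k : ℕ) (L : ℕ → ℝ) : Set (E d → ℝ) :=
  {f | ContDiffOn ℝ k f D ∧ (∀ x ∈ D, |f x| ≤ 1) ∧
    ∀ j ≤ k, ∀ i : Fin j → Fin d, ∀ x ∈ D, ∀ y ∈ D,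
      |partialDeriv j i f x - partialDeriv j i f y| ≤ L j * ‖x - y‖}

end CurseIntegration

end

/-!
Lower bound. Given nodes in `D_d`, let `K` be their convex hull and let `f` be the square of
`max (dist(x, K) - ε√d) 0`, mollified at scale `ε√d`. It vanishes at the nodes. A neighbourhood of
`K` of radius comparable to `ε√d` is covered by as many sets of exponentially small volume as there
are nodes, because `K` lies in the union of the balls having the segments from a fixed centre to
the nodes as diameters. Hence, unless there are exponentially many nodes, `f ≥ (ε√d)²` on half of
`D_d`, and so `∫ f` has order at least `d`, while `f` is bounded by `O(d)` and has Lipschitz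
constant `O(√d)`. The gradient of the squared distance is Lipschitz with a constant independent of
`d`, and the mollifier is a product of one-dimensional ones, so that its partial derivatives of
order at most `k` have `L¹`-norms bounded independently of `d`. Thus all partial derivatives of `f`
are Lipschitz with constants `O(1)`, and `f / d` is the fooling function.

Upper bound. A function of the class is within `O(L_{j,d} d^{j+1/2})` of its Taylor polynomial of
degree `j` at a fixed point. These polynomials have bounded coefficients with respect to
`O(d^j)` monomials, so by Carathéodory's theorem they are integrated almost exactly by a convex
combination of `O(d^j)` function values.
-/

open scoped Convolution ContDiff

noncomputable section

namespace CurseIntegration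

/-! ### Convex hulls and metric projections -/

section InnerProductSpace

variable {V : Type*} [NormedAddCommGroup V] [InnerProductSpace ℝ V]

theorem inner_sub_sub_eq_dist_midpoint_sq (x y z : V) :
    inner ℝ (y - x) (y - z) = dist y (midpoint ℝ x z) ^ 2 - (dist x z / 2) ^ 2 := by
  have hsum : y - midpoint ℝ x z = (1 / 2 : ℝ) • ((y - x) + (y - z)) := by
    rw [midpoint_eq_smul_add, invOf_eq_inv]
    module
  have hdiff : x - z = (y - z) - (y - x) := by abel
  rw [dist_eq_norm, dist_eq_norm, hsum, hdiff, norm_smul, mul_pow, div_pow, norm_add_sq_real,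
    norm_sub_sq_real (y - z), real_inner_comm (y - x) (y - z)]
  norm_num
  ring

/- A point `y` outside all these balls sees every `x ∈ s` strictly on the side of `z`, so the half
space `⟪y - z, · ⟫ < ⟪y - z, y⟫` contains `s`, hence its hull, but not `y`. -/
theorem convexHull_subset_iUnion_closedBall (s : Set V) (z : V) :
    convexHull ℝ s ⊆ ⋃ x ∈ s, Metric.closedBall (midpoint ℝ x z) (dist x z / 2) := by
  intro y hy
  by_contra hfar
  simp only [mem_iUnion, Metric.mem_closedBall, not_exists, not_le] at hfar
  have hsub : s ⊆ {x | innerSL ℝ (y - z) x < innerSL ℝ (y - z) y} := by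
    intro x hx
    have hpos : 0 < inner ℝ (y - z) (y - x) := by
      rw [real_inner_comm, inner_sub_sub_eq_dist_midpoint_sq, sub_pos]
      exact pow_lt_pow_left₀ (hfar x hx) (by positivity) two_ne_zero
    rwa [inner_sub_right, sub_pos] at hpos
  have hconv : Convex ℝ {x : V | innerSL ℝ (y - z) x < innerSL ℝ (y - z) y} :=
    convex_halfSpace_lt (innerSL ℝ (y - z)).toLinearMap.isLinear _
  exact lt_irrefl (innerSL ℝ (y - z) y) (convexHull_min hsub hconv hy)

theorem cthickening_convexHull_subset {s : Set V} (hs : s.Finite) (z : V) {r : ℝ} (hr : 0 ≤ r) :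
    Metric.cthickening r (convexHull ℝ s) ⊆
      ⋃ x ∈ s, Metric.closedBall (midpoint ℝ x z) (dist x z / 2 + r) := by
  rw [(hs.isCompact_convexHull ℝ).cthickening_eq_biUnion_closedBall hr]
  simp only [iUnion_subset_iff]
  intro y hy w hw
  obtain ⟨x, hx, hyx⟩ := mem_iUnion₂.1 (convexHull_subset_iUnion_closedBall s z hy)
  refine mem_iUnion₂.2 ⟨x, hx, ?_⟩
  rw [Metric.mem_closedBall] at hw hyx ⊢
  linarith [dist_triangle w y (midpoint ℝ x z)]

/-- `P` sends each point to its nearest point in the convex set `K`, which is encoded by the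
variational inequality characterizing nearest points. -/
structure IsMetricProj (P : V → V) (K : Set V) : Prop where
  mem : ∀ x, P x ∈ K
  inner_le_zero : ∀ x, ∀ w ∈ K, inner ℝ (x - P x) (w - P x) ≤ 0

theorem exists_isMetricProj {K : Set V} (hne : K.Nonempty) (hcomplete : IsComplete K)
    (hconv : Convex ℝ K) : ∃ P, IsMetricProj P K := by
  choose P hmem hmin using exists_norm_eq_iInf_of_complete_convex hne hcomplete hconv
  exact ⟨P, hmem, fun x => (norm_eq_iInf_iff_real_inner_le_zero hconv (hmem x)).1 (hmin x)⟩

namespace IsMetricProj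

variable {P : V → V} {K : Set V}

theorem infDist_eq (hP : IsMetricProj P K) (x : V) : Metric.infDist x K = ‖x - P x‖ := by
  apply le_antisymm
  · rw [← dist_eq_norm]
    exact Metric.infDist_le_dist_of_mem (hP.mem x)
  · refine (Metric.le_infDist ⟨P x, hP.mem x⟩).2 fun w hw => ?_
    have hsq : ‖x - w‖ ^ 2 =
        ‖x - P x‖ ^ 2 - 2 * inner ℝ (x - P x) (w - P x) + ‖w - P x‖ ^ 2 := by
      rw [← norm_sub_sq_real, sub_sub_sub_cancel_right]
    rw [dist_eq_norm]
    refine le_of_sq_le_sq ?_ (norm_nonneg _)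
    linarith [hP.inner_le_zero x w hw, sq_nonneg ‖w - P x‖]

theorem norm_sub_sq_le_inner (hP : IsMetricProj P K) (x y : V) :
    ‖(x - P x) - (y - P y)‖ ^ 2 ≤ inner ℝ ((x - P x) - (y - P y)) (x - y) := by
  have hsplit : inner ℝ ((x - P x) - (y - P y)) (x - y) = ‖(x - P x) - (y - P y)‖ ^ 2
      - inner ℝ (x - P x) (P y - P x) - inner ℝ (y - P y) (P x - P y) := by
    rw [← real_inner_self_eq_norm_sq]
    simp only [inner_sub_left, inner_sub_right]
    ring
  linarith [hP.inner_le_zero x _ (hP.mem y), hP.inner_le_zero y _ (hP.mem x)]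

theorem norm_sub_le (hP : IsMetricProj P K) (x y : V) :
    ‖(x - P x) - (y - P y)‖ ≤ ‖x - y‖ := by
  have hcs := (hP.norm_sub_sq_le_inner x y).trans (real_inner_le_norm _ _)
  by_contra! hlt
  nlinarith [norm_nonneg (x - y)]

theorem infDist_sq_le (hP : IsMetricProj P K) (x y : V) :
    Metric.infDist y K ^ 2 ≤
      Metric.infDist x K ^ 2 + 2 * inner ℝ (x - P x) (y - x) + ‖y - x‖ ^ 2 := by
  have hle : Metric.infDist y K ≤ ‖(x - P x) + (y - x)‖ := by
    rw [sub_add_sub_comm, add_comm, add_sub_add_right_eq_sub, ← dist_eq_norm]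
    exact Metric.infDist_le_dist_of_mem (hP.mem x)
  rw [hP.infDist_eq x, ← norm_add_sq_real]
  gcongr
  exact Metric.infDist_nonneg

theorem hasFDerivAt_infDist_sq (hP : IsMetricProj P K) (x : V) :
    HasFDerivAt (fun x => Metric.infDist x K ^ 2) ((2 : ℝ) • innerSL ℝ (x - P x)) x := by
  rw [hasFDerivAt_iff_isLittleO_nhds_zero]
  refine (Asymptotics.IsBigO.of_bound 1 (Eventually.of_forall fun h => ?_)).trans_isLittleO
    (Asymptotics.isLittleO_norm_pow_id one_lt_two)
  have hupper := hP.infDist_sq_le x (x + h)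
  have hlower := hP.infDist_sq_le (x + h) x
  have hmono := (sq_nonneg _).trans (hP.norm_sub_sq_le_inner (x + h) x)
  rw [add_sub_cancel_left] at hupper hmono
  rw [sub_add_cancel_left, inner_neg_right, norm_neg] at hlower
  rw [inner_sub_left] at hmono
  simp only [smul_apply, innerSL_apply_apply, smul_eq_mul, Real.norm_eq_abs, one_mul, abs_pow,
    abs_norm]
  rw [abs_le]
  constructor <;> linarith

end IsMetricProj

theorem lipschitzWith_fderiv_infDist_sq {K : Set V} (hne : K.Nonempty) (hcomplete : IsComplete K)
    (hconv : Convex ℝ K) : LipschitzWith 2 (fderiv ℝ fun x => Metric.infDist x K ^ 2) := by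
  obtain ⟨P, hP⟩ := exists_isMetricProj hne hcomplete hconv
  refine LipschitzWith.of_dist_le_mul fun x y => ?_
  rw [(hP.hasFDerivAt_infDist_sq x).fderiv, (hP.hasFDerivAt_infDist_sq y).fderiv, dist_eq_norm,
    dist_eq_norm, ← smul_sub, ← map_sub, norm_smul, innerSL_apply_norm, Real.norm_two,
    NNReal.coe_ofNat]
  gcongr
  exact hP.norm_sub_le x y

theorem contDiff_infDist_sq {K : Set V} (hne : K.Nonempty) (hcomplete : IsComplete K)
    (hconv : Convex ℝ K) : ContDiff ℝ 1 fun x => Metric.infDist x K ^ 2 := by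
  obtain ⟨P, hP⟩ := exists_isMetricProj hne hcomplete hconv
  exact contDiff_one_iff_fderiv.2 ⟨fun x => (hP.hasFDerivAt_infDist_sq x).differentiableAt,
    (lipschitzWith_fderiv_infDist_sq hne hcomplete hconv).continuous⟩

end InnerProductSpace

/-! ### Volume estimates -/

theorem measureReal_closedBall_le_exp_mul_integral {V : Type*} [SeminormedAddCommGroup V]
    [MeasurableSpace V] {μ : Measure V} {s : ℝ} (hs : 0 ≤ s) (R : ℝ) {c : V}
    (hint : Integrable (fun x => Real.exp (-s * ‖x - c‖ ^ 2)) μ) :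
    μ.real (Metric.closedBall c R) ≤
      Real.exp (s * R ^ 2) * ∫ x, Real.exp (-s * ‖x - c‖ ^ 2) ∂μ := by
  have hsub : Metric.closedBall c R ⊆
      {x | Real.exp (-s * R ^ 2) ≤ Real.exp (-s * ‖x - c‖ ^ 2)} := by
    intro x hx
    rw [Metric.mem_closedBall, dist_eq_norm] at hx
    rw [mem_ofPred_eq, Real.exp_le_exp, neg_mul, neg_mul, neg_le_neg_iff]
    gcongr
  have hmarkov := mul_meas_ge_le_integral_of_nonneg
    (Eventually.of_forall fun x => (Real.exp_pos (-s * ‖x - c‖ ^ 2)).le) hint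
    (Real.exp (-s * R ^ 2))
  have hmono := measureReal_mono hsub (hint.measure_ge_lt_top (Real.exp_pos _)).ne
  calc μ.real (Metric.closedBall c R)
      = Real.exp (s * R ^ 2) * (Real.exp (-s * R ^ 2) * μ.real (Metric.closedBall c R)) := by
        rw [← mul_assoc, ← Real.exp_add, neg_mul, add_neg_cancel, Real.exp_zero, one_mul]
    _ ≤ Real.exp (s * R ^ 2) * ∫ x, Real.exp (-s * ‖x - c‖ ^ 2) ∂μ := by
        gcongr
        exact (mul_le_mul_of_nonneg_left hmono (Real.exp_pos _).le).trans hmarkov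

theorem measureReal_closedBall_mul_sqrt_finrank_le {V : Type*} [NormedAddCommGroup V]
    [InnerProductSpace ℝ V] [FiniteDimensional ℝ V] [MeasurableSpace V] [BorelSpace V] (c : V)
    {ρ : ℝ} (hρ : 0 < ρ) :
    volume.real (Metric.closedBall c (ρ * √(Module.finrank ℝ V))) ≤
      (ρ * √(2 * Real.pi * Real.exp 1)) ^ Module.finrank ℝ V := by
  set n := Module.finrank ℝ V
  -- The Chernoff bound with the Gaussian weight `exp (-s ‖x - c‖²)` is optimal for this `s`.
  set s := 1 / (2 * ρ ^ 2) with hs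
  have hs_pos : 0 < s := by positivity
  have hgauss : ∫ x : V, Real.exp (-s * ‖x - c‖ ^ 2) = (Real.pi / s) ^ ((n : ℝ) / 2) := by
    rw [integral_sub_right_eq_self (fun x : V => Real.exp (-s * ‖x‖ ^ 2)) c,
      GaussianFourier.integral_rexp_neg_mul_sq_norm hs_pos]
  have hint : Integrable fun x : V => Real.exp (-s * ‖x - c‖ ^ 2) := by
    refine Integrable.of_integral_ne_zero ?_
    rw [hgauss]
    positivity
  have hexponent : s * (ρ * √n) ^ 2 = n * (1 / 2) := by
    rw [hs, mul_pow, Real.sq_sqrt n.cast_nonneg]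
    field_simp
  have hwidth : Real.pi / s = 2 * Real.pi * ρ ^ 2 := by rw [hs]; field_simp
  have hbase : ρ * √(2 * Real.pi * Real.exp 1) = Real.exp (1 / 2) * √(2 * Real.pi * ρ ^ 2) := by
    rw [Real.sqrt_mul (by positivity), Real.sqrt_mul (by positivity) (ρ ^ 2),
      Real.sqrt_sq hρ.le, Real.exp_half]
    ring
  refine (measureReal_closedBall_le_exp_mul_integral hs_pos.le _ hint).trans_eq ?_
  rw [hgauss, hexponent, hwidth, hbase, mul_pow, ← Real.exp_nat_mul, Real.sqrt_eq_rpow,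
    ← Real.rpow_mul_natCast (by positivity), div_mul_eq_mul_div, one_mul]

theorem exp_mul_exp_neg_sq_sub_le {u v : ℝ} (hu : |u| ≤ 1 / 4) (hv : |v| ≤ 1 / 2) :
    Real.exp (1 / 6 * u ^ 2) * Real.exp (-(1 / 6) * (v - u) ^ 2) ≤
      1 + 1 / 6 * (2 * u * v - v ^ 2) + 1 / 144 := by
  have hexponent : 1 / 6 * u ^ 2 + -(1 / 6) * (v - u) ^ 2 = 1 / 6 * (2 * u * v - v ^ 2) := by ring
  rw [← Real.exp_add, hexponent]
  set t := 1 / 6 * (2 * u * v - v ^ 2) with ht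
  have ht_le : |t| ≤ 1 / 12 := by
    have hdiff : |2 * u - v| ≤ 1 := by
      rw [abs_le] at hu hv ⊢
      constructor <;> linarith
    have hfactor : t = 1 / 6 * (v * (2 * u - v)) := by rw [ht]; ring
    calc |t| = 1 / 6 * (|v| * |2 * u - v|) := by
          rw [hfactor, abs_mul, abs_mul, abs_of_pos (by norm_num)]
      _ ≤ 1 / 6 * (1 / 2 * 1) := by gcongr
      _ = 1 / 12 := by norm_num
  have htaylor := (abs_le.1 (Real.abs_exp_sub_one_sub_id_le (ht_le.trans (by norm_num)))).2
  have hsq : t ^ 2 ≤ (1 / 12) ^ 2 := sq_le_sq' (abs_le.1 ht_le).1 (abs_le.1 ht_le).2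
  linarith

theorem exp_mul_setIntegral_Ioo_gaussian_le {c : ℝ} (hc : |c - 1 / 2| ≤ 1 / 4) :
    Real.exp (1 / 6 * (c - 1 / 2) ^ 2) * ∫ y in Ioo (0 : ℝ) 1, Real.exp (-(1 / 6) * (y - c) ^ 2) ≤
      143 / 144 := by
  set u := c - 1 / 2 with hu
  have hle : ∀ y ∈ Ioo (0 : ℝ) 1, Real.exp (1 / 6 * u ^ 2) * Real.exp (-(1 / 6) * (y - c) ^ 2) ≤
      1 + 1 / 6 * (2 * u * (y - 1 / 2) - (y - 1 / 2) ^ 2) + 1 / 144 := by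
    intro y hy
    have hv : |y - 1 / 2| ≤ 1 / 2 := by
      rw [abs_le]
      constructor <;> linarith [hy.1, hy.2]
    have hyc : y - c = (y - 1 / 2) - u := by rw [hu]; ring
    rw [hyc]
    exact exp_mul_exp_neg_sq_sub_le hc hv
  have hintegrableOn : ∀ {f : ℝ → ℝ}, Continuous f → IntegrableOn f (Ioo 0 1) := fun hf =>
    hf.integrableOn_Icc.mono_set Ioo_subset_Icc_self
  calc Real.exp (1 / 6 * u ^ 2) * ∫ y in Ioo (0 : ℝ) 1, Real.exp (-(1 / 6) * (y - c) ^ 2)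
      ≤ ∫ y in Ioo (0 : ℝ) 1, (1 + 1 / 6 * (2 * u * (y - 1 / 2) - (y - 1 / 2) ^ 2) + 1 / 144) := by
        rw [← integral_const_mul]
        exact setIntegral_mono_on (hintegrableOn (by fun_prop)) (hintegrableOn (by fun_prop))
          measurableSet_Ioo hle
    _ = ∫ y in (0 : ℝ)..1, (139 / 144 - u / 6 + (1 / 6 + u / 3) * y - 1 / 6 * y ^ 2) := by
        rw [← integral_Ioc_eq_integral_Ioo, ← intervalIntegral.integral_of_le zero_le_one]
        congr 1 with y
        ring
    _ = 143 / 144 := by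
        rw [intervalIntegral.integral_sub, intervalIntegral.integral_add,
          intervalIntegral.integral_const_mul, intervalIntegral.integral_const_mul, integral_pow,
          integral_id, intervalIntegral.integral_const]
        · norm_num
          ring
        all_goals exact Continuous.intervalIntegrable (by fun_prop) _ _

section openCube

variable {d : ℕ}

theorem openCube_eq_preimage :
    openCube d = WithLp.ofLp ⁻¹' (univ.pi fun _ : Fin d => Ioo (0 : ℝ) 1) := by
  ext x
  simp [openCube, Set.mem_pi]

theorem isOpen_openCube : IsOpen (openCube d) := by
  rw [openCube_eq_preimage]
  exact (isOpen_set_pi finite_univ fun _ _ => isOpen_Ioo).preimage (PiLp.continuous_ofLp 2 _)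

theorem convex_openCube : Convex ℝ (openCube d) :=
  fun _ hx _ hy _ _ ha hb hab i => convex_Ioo (0 : ℝ) 1 (hx i) (hy i) ha hb hab

theorem measurePreserving_ofLp_openCube :
    MeasurePreserving (WithLp.ofLp : E d → Fin d → ℝ) (volume.restrict (openCube d))
      (Measure.pi fun _ : Fin d => (volume.restrict (Ioo (0 : ℝ) 1))) := by
  have hrestrict := (EuclideanSpace.volume_preserving_symm_measurableEquiv_toLp
    (Fin d)).restrict_preimage (MeasurableSet.univ_pi fun _ => measurableSet_Ioo (a := (0 : ℝ))
      (b := 1))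
  rw [volume_pi, Measure.restrict_pi_pi] at hrestrict
  rw [openCube_eq_preimage]
  exact hrestrict

theorem volume_openCube : volume (openCube d) = 1 := by
  have huniv := measurePreserving_ofLp_openCube.measure_preimage
    (MeasurableSet.univ (α := Fin d → ℝ)).nullMeasurableSet
  simpa [Measure.pi_univ] using huniv

theorem integral_openCube_prod (f : Fin d → ℝ → ℝ) :
    ∫ x in openCube d, ∏ i, f i (x i) = ∏ i, ∫ y in Ioo (0 : ℝ) 1, f i y := by
  rw [← integral_fintype_prod_eq_prod, ← measurePreserving_ofLp_openCube.integral_comp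
    (MeasurableEquiv.toLp 2 (Fin d → ℝ)).symm.measurableEmbedding]

theorem exp_mul_integral_openCube_gaussian_le {c : E d} (hc : ∀ i, |c i - 1 / 2| ≤ 1 / 4) :
    Real.exp (1 / 6 * ∑ i, (c i - 1 / 2) ^ 2) *
      ∫ x in openCube d, Real.exp (-(1 / 6) * ‖x - c‖ ^ 2) ≤ (143 / 144) ^ d := by
  have hgauss : ∀ x : E d, Real.exp (-(1 / 6) * ‖x - c‖ ^ 2) =
      ∏ i, Real.exp (-(1 / 6) * (x i - c i) ^ 2) := by
    intro x
    rw [EuclideanSpace.real_norm_sq_eq, Finset.mul_sum, Real.exp_sum]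
    rfl
  simp_rw [hgauss]
  rw [integral_openCube_prod fun i y => Real.exp (-(1 / 6) * (y - c i) ^ 2), Finset.mul_sum,
    Real.exp_sum, ← Finset.prod_mul_distrib]
  refine (Finset.prod_le_prod (fun i _ => ?_) fun i _ =>
    exp_mul_setIntegral_Ioo_gaussian_le (hc i)).trans_eq
      (by rw [Finset.prod_const, Finset.card_univ, Fintype.card_fin])
  exact mul_nonneg (Real.exp_pos _).le (integral_nonneg fun y => (Real.exp_pos _).le)

theorem measureReal_openCube_inter_closedBall_le {c : E d} (hc : ∀ i, |c i - 1 / 2| ≤ 1 / 4)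
    (R : ℝ) :
    volume.real (openCube d ∩ Metric.closedBall c R) ≤
      Real.exp (1 / 6 * (R ^ 2 - ∑ i, (c i - 1 / 2) ^ 2)) * (143 / 144) ^ d := by
  have : IsFiniteMeasure (volume.restrict (openCube d)) :=
    isFiniteMeasure_restrict.2 (by simp [volume_openCube])
  have hint : Integrable (fun x : E d => Real.exp (-(1 / 6) * ‖x - c‖ ^ 2))
      (volume.restrict (openCube d)) := by
    refine Integrable.of_bound (C := 1) (by fun_prop) (Eventually.of_forall fun x => ?_)
    rw [Real.norm_eq_abs, Real.abs_exp, Real.exp_le_one_iff, neg_mul, neg_nonpos]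
    positivity
  have hchernoff := measureReal_closedBall_le_exp_mul_integral (by norm_num) R hint
  rw [measureReal_restrict_apply Metric.isClosed_closedBall.measurableSet, inter_comm] at hchernoff
  rw [mul_sub, Real.exp_sub, div_mul_eq_mul_div, le_div_iff₀ (Real.exp_pos _)]
  refine (mul_le_mul_of_nonneg_right hchernoff (Real.exp_pos _).le).trans ?_
  rw [mul_assoc, mul_comm (∫ x in openCube d, _)]
  gcongr
  exact exp_mul_integral_openCube_gaussian_le hc

end openCube

/-! ### Domains -/

/-- In `D`, the closed `r`-neighbourhood of the convex hull of `n` points has volume at most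
`n * p`. -/
def HullNhdsBound {V : Type*} [NormedAddCommGroup V] [InnerProductSpace ℝ V] [MeasureSpace V]
    (D : Set V) (r p : ℝ) : Prop :=
  ∀ s : Finset V, ↑s ⊆ D →
    volume.real (D ∩ Metric.cthickening r (convexHull ℝ (s : Set V))) ≤ s.card * p

theorem hullNhdsBound_of_closedBall {V : Type*} [NormedAddCommGroup V] [InnerProductSpace ℝ V]
    [MeasureSpace V] {D : Set V} (hD : volume D ≠ ⊤) {r p : ℝ} (hr : 0 ≤ r) (z : V)
    (hball : ∀ x ∈ D,
      volume.real (D ∩ Metric.closedBall (midpoint ℝ x z) (dist x z / 2 + r)) ≤ p) :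
    HullNhdsBound D r p := by
  intro s hs
  have hsub : D ∩ Metric.cthickening r (convexHull ℝ (s : Set V)) ⊆
      ⋃ x ∈ s, D ∩ Metric.closedBall (midpoint ℝ x z) (dist x z / 2 + r) := by
    rw [← inter_iUnion₂]
    exact inter_subset_inter_right _ (cthickening_convexHull_subset s.finite_toSet z hr)
  have hfinite : volume (⋃ x ∈ s, D ∩ Metric.closedBall (midpoint ℝ x z) (dist x z / 2 + r)) ≠ ⊤ :=
    ne_top_of_le_ne_top hD (measure_mono (iUnion₂_subset fun _ _ => inter_subset_left))
  calc volume.real (D ∩ Metric.cthickening r (convexHull ℝ (s : Set V)))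
      ≤ volume.real (⋃ x ∈ s, D ∩ Metric.closedBall (midpoint ℝ x z) (dist x z / 2 + r)) :=
        measureReal_mono hsub hfinite
    _ ≤ ∑ x ∈ s, volume.real (D ∩ Metric.closedBall (midpoint ℝ x z) (dist x z / 2 + r)) :=
        measureReal_biUnion_finset_le _ _
    _ ≤ s.card * p := by
        rw [← nsmul_eq_mul]
        exact Finset.sum_le_card_nsmul _ _ _ fun x hx => hball x (hs hx)

/-- Open convex sets of volume one and diameter at most `R`. -/
structure UnitConvexDomain {d : ℕ} (D : Set (E d)) (R : ℝ) : Prop where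
  isOpen : IsOpen D
  convex : Convex ℝ D
  volume_eq_one : volume D = 1
  dist_le : ∀ x ∈ D, ∀ y ∈ D, dist x y ≤ R

theorem UnitConvexDomain.nonempty {d : ℕ} {D : Set (E d)} {R : ℝ} (hD : UnitConvexDomain D R) :
    D.Nonempty :=
  nonempty_of_measure_ne_zero (hD.volume_eq_one.trans_ne one_ne_zero)

/-- Neighbourhoods of radius of order `√d` of the convex hulls of few points of `D d` are
exponentially small in the dimension. -/
def SmallHullNhds (D : ∀ d : ℕ, Set (E d)) : Prop :=
  ∃ ε q : ℝ, 0 < ε ∧ 0 < q ∧ q < 1 ∧ ∀ᶠ d : ℕ in atTop, HullNhdsBound (D d) (ε * √d) (q ^ d)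

theorem dist_le_sqrt_of_mem_openCube {d : ℕ} {x y : E d} (hx : x ∈ openCube d)
    (hy : y ∈ openCube d) : dist x y ≤ √d := by
  rw [EuclideanSpace.dist_eq]
  refine Real.sqrt_le_sqrt ?_
  refine (Finset.sum_le_card_nsmul _ _ 1 fun i _ => ?_).trans_eq (by simp)
  refine pow_le_one₀ dist_nonneg ?_
  rw [Real.dist_eq, abs_le]
  constructor <;> linarith [(hx i).1, (hx i).2, (hy i).1, (hy i).2]

theorem unitConvexDomain_openCube (d : ℕ) : UnitConvexDomain (openCube d) √d :=
  ⟨isOpen_openCube, convex_openCube, volume_openCube,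
    fun _ hx _ hy => dist_le_sqrt_of_mem_openCube hx hy⟩

theorem hullNhdsBound_openCube (d : ℕ) :
    HullNhdsBound (openCube d) (1 / 100 * √d)
      ((Real.exp (101 / 60000) * (143 / 144)) ^ d) := by
  set z : E d := WithLp.toLp 2 fun _ => 1 / 2 with hz
  have hz_mem : z ∈ openCube d := fun i => by norm_num [hz]
  refine hullNhdsBound_of_closedBall (by simp [volume_openCube]) (by positivity) z fun x hx => ?_
  set c := midpoint ℝ x z
  have hcoord : ∀ i, c i - 1 / 2 = 1 / 2 * (x i - z i) := fun i => by
    rw [show c = (⅟2 : ℝ) • (x + z) from midpoint_eq_smul_add ℝ x z]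
    simp only [PiLp.smul_apply, PiLp.add_apply, smul_eq_mul, invOf_eq_inv, hz]
    ring
  have hcenter : ∀ i, |c i - 1 / 2| ≤ 1 / 4 := fun i => by
    rw [hcoord, abs_le, show z i = 1 / 2 from rfl]
    constructor <;> linarith [(hx i).1, (hx i).2]
  have hsum : ∑ i, (c i - 1 / 2) ^ 2 = (dist x z / 2) ^ 2 := by
    rw [dist_eq_norm, div_pow, EuclideanSpace.real_norm_sq_eq, Finset.sum_div]
    refine Finset.sum_congr rfl fun i _ => ?_
    rw [hcoord, PiLp.sub_apply]
    ring
  have hexponent : 1 / 6 * ((dist x z / 2 + 1 / 100 * √d) ^ 2 - (dist x z / 2) ^ 2) ≤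
      d * (101 / 60000) := by
    have hsq : √(d : ℝ) ^ 2 = d := Real.sq_sqrt d.cast_nonneg
    nlinarith [mul_le_mul_of_nonneg_right (dist_le_sqrt_of_mem_openCube hx hz_mem)
      (Real.sqrt_nonneg d)]
  refine (measureReal_openCube_inter_closedBall_le hcenter _).trans ?_
  rw [mul_pow, ← Real.exp_nat_mul, hsum]
  gcongr

theorem smallHullNhds_openCube : SmallHullNhds openCube := by
  refine ⟨1 / 100, Real.exp (101 / 60000) * (143 / 144), by norm_num, by positivity, ?_,
    Eventually.of_forall hullNhdsBound_openCube⟩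
  have hexp := Real.exp_bound_div_one_sub_of_interval (x := 101 / 60000) (by norm_num)
    (by norm_num)
  linarith

theorem hullNhdsBound_of_subset_closedBall {d : ℕ} {D : Set (E d)} {ε r : ℝ} {z : E d}
    (hε : 0 < ε) (hr : 0 ≤ r) (hD : D ⊆ Metric.closedBall z (r * √d)) :
    HullNhdsBound D (ε * √d) (((r / 2 + ε) * √(2 * Real.pi * Real.exp 1)) ^ d) := by
  have hfinite : volume D ≠ ⊤ :=
    measure_ne_top_of_subset hD measure_closedBall_lt_top.ne
  refine hullNhdsBound_of_closedBall hfinite (by positivity) z fun x hx => ?_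
  have hball := measureReal_closedBall_mul_sqrt_finrank_le (midpoint ℝ x z)
    (by positivity : 0 < r / 2 + ε)
  rw [finrank_euclideanSpace_fin] at hball
  refine (measureReal_mono ?_ measure_closedBall_lt_top.ne).trans hball
  refine inter_subset_right.trans (Metric.closedBall_subset_closedBall ?_)
  linarith [Metric.mem_closedBall.1 (hD hx)]

theorem exists_subset_closedBall_of_rad_lt {d : ℕ} {D : Set (E d)} {r : ℝ} (hr : 0 ≤ r)
    (hrad : rad D < ENNReal.ofReal r) : ∃ z, D ⊆ Metric.closedBall z r := by
  obtain ⟨z, hz⟩ := iInf_lt_iff.1 hrad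
  refine ⟨z, fun y hy => ?_⟩
  have hle : edist y z ≤ ENNReal.ofReal r :=
    (le_iSup₂ (f := fun y _ => edist y z) y hy).trans hz.le
  rwa [edist_dist, ENNReal.ofReal_le_ofReal_iff hr] at hle

theorem ConvexSmallRadius.exists_subset_closedBall {D : ∀ d : ℕ, Set (E d)}
    (hD : ConvexSmallRadius D) :
    ∃ r, 0 ≤ r ∧ r < √(2 / (Real.pi * Real.exp 1)) ∧
      ∀ᶠ d : ℕ in atTop, ∃ z, D d ⊆ Metric.closedBall z (r * √d) := by
  obtain ⟨a, hlimsup, ha⟩ := exists_between hD.limsup_rad_lt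
  obtain ⟨r, hr, rfl⟩ : ∃ r, 0 ≤ r ∧ a = ENNReal.ofReal r :=
    ⟨a.toReal, ENNReal.toReal_nonneg, (ENNReal.ofReal_toReal ha.ne_top).symm⟩
  refine ⟨r, hr, (ENNReal.ofReal_lt_ofReal_iff_of_nonneg hr).1 ha, ?_⟩
  filter_upwards [eventually_ge_atTop 1, eventually_lt_of_limsup_lt hlimsup] with d hd hrad
  have hsqrt : 0 < √(d : ℝ) := Real.sqrt_pos.2 (by exact_mod_cast hd)
  rw [ENNReal.div_lt_iff (by simp [hsqrt]) (by simp), ← ENNReal.ofReal_mul hr] at hrad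
  exact exists_subset_closedBall_of_rad_lt (by positivity) hrad

theorem ConvexSmallRadius.exists_unitConvexDomain {D : ∀ d : ℕ, Set (E d)}
    (hD : ConvexSmallRadius D) : ∃ R : ℝ, ∀ᶠ d : ℕ in atTop, UnitConvexDomain (D d) (R * √d) := by
  obtain ⟨r, -, -, hball⟩ := hD.exists_subset_closedBall
  refine ⟨2 * r, ?_⟩
  filter_upwards [eventually_ge_atTop 1, hball] with d hd ⟨z, hz⟩
  refine ⟨hD.isOpen d hd, hD.convex d hd, hD.volume_eq_one d hd, fun x hx y hy => ?_⟩
  linarith [dist_triangle_right x y z, Metric.mem_closedBall.1 (hz hx),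
    Metric.mem_closedBall.1 (hz hy)]

/- The critical radius `√(2/(π e)) √d` is twice the radius of a ball of volume one, up to lower
order factors, and the hull of `n` points is covered by `n` balls of half the radius. -/
theorem ConvexSmallRadius.smallHullNhds {D : ∀ d : ℕ, Set (E d)} (hD : ConvexSmallRadius D) :
    SmallHullNhds D := by
  obtain ⟨r, hr, hr_lt, hball⟩ := hD.exists_subset_closedBall
  set κ := √(2 * Real.pi * Real.exp 1)
  have hκ : 0 < κ := by positivity
  have hcritical : √(2 / (Real.pi * Real.exp 1)) * κ = 2 := by
    rw [← Real.sqrt_mul (by positivity), Real.sqrt_eq_iff_mul_self_eq (by positivity) two_pos.le]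
    field_simp
  have hrκ : r * κ < 2 := hcritical ▸ mul_lt_mul_of_pos_right hr_lt hκ
  set ε := (2 - r * κ) / (4 * κ) with hε
  have hε_pos : 0 < ε := div_pos (by linarith) (by positivity)
  have hεκ : ε * κ = (2 - r * κ) / 4 := by rw [hε]; field_simp
  refine ⟨ε, (r / 2 + ε) * κ, hε_pos, by positivity, by linarith, ?_⟩
  filter_upwards [hball] with d ⟨z, hz⟩
  exact hullNhdsBound_of_subset_closedBall hε_pos hr hz

theorem exists_unitConvexDomain_and_smallHullNhds {D : ∀ d : ℕ, Set (E d)}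
    (hD : (∀ d, 1 ≤ d → D d = openCube d) ∨ ConvexSmallRadius D) :
    (∃ R : ℝ, ∀ᶠ d : ℕ in atTop, UnitConvexDomain (D d) (R * √d)) ∧ SmallHullNhds D := by
  rcases hD with hD | hD
  · have hcube : ∀ᶠ d in atTop, D d = openCube d := (eventually_ge_atTop 1).mono hD
    refine ⟨⟨1, hcube.mono fun d hd => ?_⟩, ?_⟩
    · rw [hd, one_mul]
      exact unitConvexDomain_openCube d
    · obtain ⟨ε, q, hε, hq, hq_lt, hbound⟩ := smallHullNhds_openCube
      refine ⟨ε, q, hε, hq, hq_lt, ?_⟩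
      filter_upwards [hcube, hbound] with d hd hbound
      rwa [hd]
  · exact ⟨hD.exists_unitConvexDomain, hD.smallHullNhds⟩

/-! ### Convolutions and mollifiers -/

section Integral

variable {V : Type*} [NormedAddCommGroup V] [MeasureSpace V] {φ g : V → ℝ}

variable [BorelSpace V] [(volume : Measure V).IsAddHaarMeasure]

theorem integrable_mul_comp_const_sub (hφ : Continuous φ) (hsupp : HasCompactSupport φ)
    (hg : Continuous g) (x : V) : Integrable fun t => φ t * g (x - t) :=
  (hφ.mul (hg.comp (by fun_prop))).integrable_of_hasCompactSupport hsupp.mul_right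

theorem abs_convolution_sub_le (hφ : Continuous φ) (hsupp : HasCompactSupport φ)
    (hg : Continuous g) {x y : V} {A : ℝ}
    (hA : ∀ t ∈ Function.support φ, |g (x - t) - g (y - t)| ≤ A) :
    |(φ ⋆ g) x - (φ ⋆ g) y| ≤ A * ∫ t, |φ t| := by
  have hint := integrable_mul_comp_const_sub hφ hsupp hg
  simp_rw [convolution_lsmul, smul_eq_mul]
  rw [← integral_sub (hint x) (hint y), ← integral_const_mul]
  refine abs_integral_le_integral_abs.trans (integral_mono ((hint x).sub (hint y)).abs
    ((hφ.integrable_of_hasCompactSupport hsupp).abs.const_mul A) fun t => ?_)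
  simp only [← mul_sub, abs_mul]
  rw [mul_comm A]
  by_cases ht : φ t = 0
  · simp [ht]
  · exact mul_le_mul_of_nonneg_left (hA t ht) (abs_nonneg _)

end Integral

section Convolution

variable {V : Type*} [NormedAddCommGroup V] [NormedSpace ℝ V] [FiniteDimensional ℝ V]
  [MeasureSpace V] {φ g : V → ℝ}

/-- A smooth probability density supported in the closed ball of radius `r` about the origin. -/
structure IsMollifier (φ : V → ℝ) (r : ℝ) : Prop where
  contDiff : ContDiff ℝ ∞ φ
  nonneg : ∀ t, 0 ≤ φ t
  integral_eq_one : ∫ t, φ t = 1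
  support_subset : Function.support φ ⊆ Metric.closedBall 0 r

theorem IsMollifier.hasCompactSupport {r : ℝ} (hφ : IsMollifier φ r) : HasCompactSupport φ :=
  .of_support_subset_isCompact (isCompact_closedBall 0 r) hφ.support_subset

variable [BorelSpace V] [(volume : Measure V).IsAddHaarMeasure]

theorem fderiv_convolution_apply (hφ : ContDiff ℝ 1 φ) (hsupp : HasCompactSupport φ)
    (hg : Continuous g) (x v : V) :
    fderiv ℝ (φ ⋆ g) x v = ((fun y => fderiv ℝ φ y v) ⋆ g) x := by
  rw [(hsupp.hasFDerivAt_convolution_left _ hφ hg.locallyIntegrable x).fderiv]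
  have hint := (hsupp.fderiv ℝ).convolutionExists_left
    ((ContinuousLinearMap.lsmul ℝ ℝ).precompL V) (hφ.continuous_fderiv one_ne_zero)
    (hg.locallyIntegrable (μ := volume)) x
  exact (ContinuousLinearMap.integral_apply hint v).trans rfl

theorem fderiv_convolution_comm (hφ : ContDiff ℝ 1 φ) (hsupp : HasCompactSupport φ)
    (hg : ContDiff ℝ 1 g) (x v : V) :
    ((fun y => fderiv ℝ φ y v) ⋆ g) x = (φ ⋆ fun y => fderiv ℝ g y v) x := by
  have hφ' : Continuous fun y => fderiv ℝ φ y v :=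
    (hφ.continuous_fderiv one_ne_zero).clm_apply continuous_const
  have hg' : Continuous fun y => fderiv ℝ g y v :=
    (hg.continuous_fderiv one_ne_zero).clm_apply continuous_const
  have hfderiv : ∀ t, fderiv ℝ (fun t => g (x - t)) t v = -fderiv ℝ g (x - t) v := fun t => by
    have hcomp : HasFDerivAt (fun t => g (x - t)) _ t :=
      (hg.differentiable one_ne_zero _).hasFDerivAt.comp t ((hasFDerivAt_id t).const_sub x)
    simp [hcomp.fderiv]
  have hparts := integral_mul_fderiv_eq_neg_fderiv_mul_of_integrable (μ := (volume : Measure V))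
    (f := φ) (g := fun t => g (x - t)) (v := v)
    (integrable_mul_comp_const_sub hφ' (hsupp.fderiv_apply ℝ v) hg.continuous x)
    (by
      simp_rw [hfderiv, mul_neg]
      exact (integrable_mul_comp_const_sub hφ.continuous hsupp hg' x).neg)
    (integrable_mul_comp_const_sub hφ.continuous hsupp hg.continuous x)
    (fun t _ => hφ.differentiable one_ne_zero t)
    (fun t _ => (hg.differentiable one_ne_zero _).comp t (by fun_prop))
  simp_rw [hfderiv, mul_neg] at hparts
  rw [integral_neg, neg_inj] at hparts
  exact hparts.symm

namespace IsMollifier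

variable {r : ℝ}

theorem contDiff_convolution (hφ : IsMollifier φ r) (hg : Continuous g) :
    ContDiff ℝ ∞ (φ ⋆ g) :=
  hφ.hasCompactSupport.contDiff_convolution_left _ hφ.contDiff hg.locallyIntegrable

theorem convolution_le (hφ : IsMollifier φ r) (hg : Continuous g) {x : V} {c : ℝ}
    (hc : ∀ y ∈ Metric.closedBall x r, g y ≤ c) : (φ ⋆ g) x ≤ c := by
  have hφ_int : Integrable φ :=
    hφ.contDiff.continuous.integrable_of_hasCompactSupport hφ.hasCompactSupport
  have hle : (φ ⋆ g) x ≤ ∫ t, φ t * c := by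
    refine integral_mono (integrable_mul_comp_const_sub hφ.contDiff.continuous
      hφ.hasCompactSupport hg x) (hφ_int.mul_const c) fun t => ?_
    by_cases ht : φ t = 0
    · simp [ht]
    · have hmem : x - t ∈ Metric.closedBall x r := by
        simpa [dist_eq_norm] using hφ.support_subset ht
      exact mul_le_mul_of_nonneg_left (hc _ hmem) (hφ.nonneg t)
  rwa [integral_mul_const, hφ.integral_eq_one, one_mul] at hle

theorem le_convolution (hφ : IsMollifier φ r) (hg : Continuous g) {x : V} {c : ℝ}
    (hc : ∀ y ∈ Metric.closedBall x r, c ≤ g y) : c ≤ (φ ⋆ g) x := by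
  have hneg := hφ.convolution_le hg.neg fun y hy => neg_le_neg (hc y hy)
  simp_rw [convolution_lsmul, smul_eq_mul, Pi.neg_apply, mul_neg, integral_neg] at hneg
  exact neg_le_neg_iff.1 hneg

theorem abs_convolution_sub_le (hφ : IsMollifier φ r) (hg : Continuous g) {x y : V} {A : ℝ}
    (hA : ∀ t ∈ Metric.closedBall 0 r, |g (x - t) - g (y - t)| ≤ A) :
    |(φ ⋆ g) x - (φ ⋆ g) y| ≤ A := by
  have hle := CurseIntegration.abs_convolution_sub_le hφ.contDiff.continuous
    hφ.hasCompactSupport hg fun t ht => hA t (hφ.support_subset ht)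
  simp_rw [abs_of_nonneg (hφ.nonneg _)] at hle
  rwa [hφ.integral_eq_one, mul_one] at hle

end IsMollifier

end Convolution

section PartialDeriv

variable {d j : ℕ} {φ g f : E d → ℝ}

theorem partialDeriv_zero (i : Fin 0 → Fin d) (f : E d → ℝ) : partialDeriv 0 i f = f := by
  ext x
  simp [partialDeriv]

theorem partialDeriv_succ (i : Fin (j + 1) → Fin d) (hf : ContDiff ℝ (j + 1) f) :
    partialDeriv (j + 1) i f = partialDeriv j (Fin.init i)
      (fun y => fderiv ℝ f y (EuclideanSpace.single (i (Fin.last j)) 1)) := by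
  ext x
  rw [partialDeriv, iteratedFDeriv_succ_apply_right, partialDeriv,
    iteratedFDeriv_clm_apply_const_apply (n := j) (hf.fderiv_right le_rfl) le_rfl]
  rfl

theorem contDiff_fderiv_apply (hφ : ContDiff ℝ ∞ φ) (v : E d) :
    ContDiff ℝ ∞ fun y => fderiv ℝ φ y v :=
  (hφ.fderiv_right (by simp)).clm_apply contDiff_const

theorem continuous_partialDeriv (i : Fin j → Fin d) (hf : ContDiff ℝ j f) :
    Continuous (partialDeriv j i f) :=
  (ContinuousMultilinearMap.apply ℝ (fun _ : Fin j => E d) ℝ _).continuous.comp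
    hf.continuous_iteratedFDeriv'

theorem hasCompactSupport_partialDeriv (i : Fin j → Fin d) (hφ : HasCompactSupport φ) :
    HasCompactSupport (partialDeriv j i φ) :=
  (hφ.iteratedFDeriv (𝕜 := ℝ) j).comp_left
    (g := fun T : ContinuousMultilinearMap ℝ (fun _ : Fin j => E d) ℝ =>
      T fun m => EuclideanSpace.single (i m) 1) rfl

theorem partialDeriv_convolution (i : Fin j → Fin d) (hφ : ContDiff ℝ ∞ φ)
    (hsupp : HasCompactSupport φ) (hg : Continuous g) :
    partialDeriv j i (φ ⋆ g) = partialDeriv j i φ ⋆ g := by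
  induction j generalizing φ with
  | zero => simp_rw [partialDeriv_zero]
  | succ j ih =>
    have hsmooth : ContDiff ℝ ∞ (φ ⋆ g) :=
      hsupp.contDiff_convolution_left _ hφ hg.locallyIntegrable
    rw [partialDeriv_succ i (hφ.of_le (by exact_mod_cast le_top)),
      partialDeriv_succ i (hsmooth.of_le (by exact_mod_cast le_top)),
      ← ih _ (contDiff_fderiv_apply hφ _) (hsupp.fderiv_apply ℝ _)]
    congr 1
    ext y
    exact fderiv_convolution_apply (hφ.of_le (by simp)) hsupp hg y _

theorem partialDeriv_succ_convolution (i : Fin (j + 1) → Fin d) (hφ : ContDiff ℝ ∞ φ)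
    (hsupp : HasCompactSupport φ) (hg : ContDiff ℝ 1 g) :
    partialDeriv (j + 1) i (φ ⋆ g) = partialDeriv j (Fin.init i) φ ⋆
      fun y => fderiv ℝ g y (EuclideanSpace.single (i (Fin.last j)) 1) := by
  have hsmooth : ContDiff ℝ ∞ (φ ⋆ g) :=
    hsupp.contDiff_convolution_left _ hφ hg.continuous.locallyIntegrable
  rw [partialDeriv_succ i (hsmooth.of_le (by exact_mod_cast le_top)), ← partialDeriv_convolution _
    hφ hsupp ((hg.continuous_fderiv one_ne_zero).clm_apply continuous_const)]
  congr 1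
  ext y
  rw [fderiv_convolution_apply (hφ.of_le (by simp)) hsupp hg.continuous,
    fderiv_convolution_comm (hφ.of_le (by simp)) hsupp hg]

theorem abs_partialDeriv_succ_convolution_sub_le (i : Fin (j + 1) → Fin d) (hφ : ContDiff ℝ ∞ φ)
    (hsupp : HasCompactSupport φ) (hg : ContDiff ℝ 1 g) {K : NNReal}
    (hlip : LipschitzWith K (fderiv ℝ g)) (x y : E d) :
    |partialDeriv (j + 1) i (φ ⋆ g) x - partialDeriv (j + 1) i (φ ⋆ g) y| ≤
      K * ‖x - y‖ * ∫ t, |partialDeriv j (Fin.init i) φ t| := by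
  rw [partialDeriv_succ_convolution i hφ hsupp hg]
  refine abs_convolution_sub_le (continuous_partialDeriv _ (hφ.of_le (by exact_mod_cast le_top)))
    (hasCompactSupport_partialDeriv _ hsupp)
    ((hg.continuous_fderiv one_ne_zero).clm_apply continuous_const) fun t _ => ?_
  rw [← sub_apply, ← Real.norm_eq_abs]
  refine (ContinuousLinearMap.le_opNorm _ _).trans ?_
  simpa [dist_eq_norm] using hlip.dist_le_mul (x - t) (y - t)

end PartialDeriv

/-! ### Product mollifiers -/

section TensorProd

variable {d : ℕ} {f : Fin d → ℝ → ℝ}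

/-- The tensor product of functions of one variable, as a function on `ℝ^d`. -/
def tensorProd (f : Fin d → ℝ → ℝ) (x : E d) : ℝ := ∏ l, f l (x l)

theorem contDiff_tensorProd {n : WithTop ℕ∞} (hf : ∀ l, ContDiff ℝ n (f l)) :
    ContDiff ℝ n (tensorProd f) :=
  contDiff_prod fun l _ => (hf l).comp (by fun_prop)

theorem integral_tensorProd (f : Fin d → ℝ → ℝ) : ∫ x, tensorProd f x = ∏ l, ∫ t, f l t := by
  rw [← integral_fintype_prod_volume_eq_prod,
    ← (EuclideanSpace.volume_preserving_symm_measurableEquiv_toLp (Fin d)).integral_comp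
      (MeasurableEquiv.toLp 2 (Fin d → ℝ)).symm.measurableEmbedding]
  rfl

theorem support_tensorProd_subset {r : ℝ} (hr : 0 ≤ r)
    (hf : ∀ l, Function.support (f l) ⊆ Metric.closedBall 0 r) :
    Function.support (tensorProd f) ⊆ Metric.closedBall 0 (r * √d) := by
  intro x hx
  have hcoord : ∀ l, x l ^ 2 ≤ r ^ 2 := fun l => by
    have hmem := hf l (Finset.prod_ne_zero_iff.1 hx l (Finset.mem_univ l))
    rw [Metric.mem_closedBall, dist_zero_right] at hmem
    exact sq_le_sq' (neg_le_of_abs_le hmem) (le_of_abs_le hmem)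
  rw [Metric.mem_closedBall, dist_zero_right]
  refine le_of_sq_le_sq ?_ (by positivity)
  calc ‖x‖ ^ 2 = ∑ l, x l ^ 2 := EuclideanSpace.real_norm_sq_eq x
    _ ≤ ∑ _l : Fin d, r ^ 2 := Finset.sum_le_sum fun l _ => hcoord l
    _ = (r * √d) ^ 2 := by simp [mul_pow, mul_comm]

theorem fderiv_tensorProd_single (hf : ∀ l, ContDiff ℝ 1 (f l)) (x : E d) (a : Fin d) :
    fderiv ℝ (tensorProd f) x (EuclideanSpace.single a 1) =
      tensorProd (Function.update f a (deriv (f a))) x := by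
  have hsplit : ∀ (g : ℝ → ℝ) (t : ℝ),
      tensorProd (Function.update f a g) (x + t • EuclideanSpace.single a 1) =
        g (x a + t) * ∏ l ∈ Finset.univ.erase a, f l (x l) := fun g t => by
    rw [tensorProd, ← Finset.mul_prod_erase _ _ (Finset.mem_univ a)]
    congr 1
    · simp
    · refine Finset.prod_congr rfl fun l hl => ?_
      simp [Finset.ne_of_mem_erase hl]
  have hdiff : DifferentiableAt ℝ (tensorProd f) x :=
    (contDiff_tensorProd hf).differentiable one_ne_zero x
  have hline : HasLineDerivAt ℝ (tensorProd f)
      (deriv (f a) (x a) * ∏ l ∈ Finset.univ.erase a, f l (x l)) x (EuclideanSpace.single a 1) := by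
    have hderiv : HasDerivAt (fun t => f a (x a + t)) (deriv (f a) (x a)) 0 := by
      simpa using
        ((hf a).differentiable one_ne_zero (x a + 0)).hasDerivAt.comp_const_add (x a) 0
    simpa [HasLineDerivAt, ← hsplit] using
      hderiv.mul_const (∏ l ∈ Finset.univ.erase a, f l (x l))
  rw [← hdiff.lineDeriv_eq_fderiv, hline.lineDeriv]
  simpa using (hsplit (deriv (f a)) 0).symm

theorem partialDeriv_tensorProd {j : ℕ} (i : Fin j → Fin d) (hf : ∀ l, ContDiff ℝ ∞ (f l)) :
    partialDeriv j i (tensorProd f) =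
      tensorProd fun l => iteratedDeriv (∑ m, if i m = l then 1 else 0) (f l) := by
  induction j generalizing f with
  | zero => simp [partialDeriv_zero]
  | succ j ih =>
    set a := i (Fin.last j)
    have hupdate : ∀ l, ContDiff ℝ ∞ (Function.update f a (deriv (f a)) l) := fun l => by
      rcases eq_or_ne l a with rfl | hl
      · simpa using (contDiff_infty_iff_deriv.1 (hf _)).2
      · simpa [hl] using hf l
    rw [partialDeriv_succ i ((contDiff_tensorProd hf).of_le (by exact_mod_cast le_top)),
      funext fun y => fderiv_tensorProd_single (fun l => (hf l).of_le (by simp)) y a,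
      ih _ hupdate]
    congr 1
    ext1 l
    have hcount : (∑ m, if i m = l then 1 else 0) =
        (∑ m, if Fin.init i m = l then 1 else 0) + if a = l then 1 else 0 :=
      Fin.sum_univ_castSucc _
    rw [hcount]
    rcases eq_or_ne l a with rfl | hl
    · simp [iteratedDeriv_succ', -Finset.sum_boole]
    · simp [hl, hl.symm, -Finset.sum_boole]

end TensorProd

section ProductMollifier

variable {d : ℕ} {ρ : ℝ → ℝ} {r : ℝ}

theorem IsMollifier.tensorProd (hρ : IsMollifier ρ r) (hr : 0 ≤ r) :
    IsMollifier (tensorProd fun _ : Fin d => ρ) (r * √d) where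
  contDiff := contDiff_tensorProd fun _ => hρ.contDiff
  nonneg _ := Finset.prod_nonneg fun _ _ => hρ.nonneg _
  integral_eq_one := by simp [integral_tensorProd, hρ.integral_eq_one]
  support_subset := support_tensorProd_subset hr fun _ => hρ.support_subset

theorem IsMollifier.integral_abs_partialDeriv_tensorProd_le (hρ : IsMollifier ρ r) {k j : ℕ} {M : ℝ}
    (hM : 1 ≤ M) (hρM : ∀ m ≤ k, ∫ t, |iteratedDeriv m ρ t| ≤ M) (hj : j ≤ k)
    (i : Fin j → Fin d) :
    ∫ x, |partialDeriv j i (CurseIntegration.tensorProd fun _ : Fin d => ρ) x| ≤ M ^ j := by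
  set n : Fin d → ℕ := fun l => ∑ m, if i m = l then 1 else 0
  have hn : ∑ l, n l = j := by
    rw [Finset.sum_comm]
    simp
  have hfactor : ∀ l, ∫ t, |iteratedDeriv (n l) ρ t| ≤ M ^ n l := fun l => by
    rcases Nat.eq_zero_or_pos (n l) with h0 | hpos
    · simp [h0, abs_of_nonneg (hρ.nonneg _), hρ.integral_eq_one]
    · have hle : n l ≤ ∑ l, n l := Finset.single_le_sum (fun _ _ => Nat.zero_le _)
        (Finset.mem_univ l)
      exact (hρM _ (by omega)).trans (le_self_pow₀ hM hpos.ne')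
  rw [partialDeriv_tensorProd i fun _ => hρ.contDiff]
  simp_rw [CurseIntegration.tensorProd, Finset.abs_prod]
  calc ∫ x : E d, ∏ l, |iteratedDeriv (n l) ρ (x l)|
      = ∏ l, ∫ t, |iteratedDeriv (n l) ρ t| :=
        integral_tensorProd fun l t => |iteratedDeriv (n l) ρ t|
    _ ≤ ∏ l, M ^ n l := Finset.prod_le_prod (fun _ _ => integral_nonneg fun _ => abs_nonneg _)
        fun l _ => hfactor l
    _ = M ^ j := by rw [Finset.prod_pow_eq_pow_sum, hn]

theorem exists_isMollifier_real (hr : 0 < r) : ∃ ρ : ℝ → ℝ, IsMollifier ρ r := by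
  let b : ContDiffBump (0 : ℝ) := ⟨r / 2, r, by positivity, by linarith⟩
  refine ⟨b.normed volume, b.contDiff_normed, b.nonneg_normed, b.integral_normed, ?_⟩
  rw [b.support_normed_eq]
  exact Metric.ball_subset_closedBall

-- The support may spread with the dimension as `√d`; only then do the bounds not depend on `d`.
theorem exists_isMollifier_integral_abs_partialDeriv_le (k : ℕ) (hr : 0 < r) :
    ∃ C : ℝ, 0 < C ∧ ∀ d : ℕ, ∃ φ : E d → ℝ, IsMollifier φ (r * √d) ∧
      ∀ j ≤ k, ∀ i : Fin j → Fin d, ∫ x, |partialDeriv j i φ x| ≤ C := by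
  obtain ⟨ρ, hρ⟩ := exists_isMollifier_real hr
  set I : ℕ → ℝ := fun m => ∫ t, |iteratedDeriv m ρ t|
  have hI : ∀ m, 0 ≤ I m := fun _ => integral_nonneg fun _ => abs_nonneg _
  set M : ℝ := 1 + ∑ m ∈ Finset.range (k + 1), I m
  have hM : 1 ≤ M := le_add_of_nonneg_right (Finset.sum_nonneg fun m _ => hI m)
  have hIM : ∀ m ≤ k, I m ≤ M := fun m hm =>
    (Finset.single_le_sum (fun m _ => hI m) (Finset.mem_range_succ_iff.2 hm)).trans
      (le_add_of_nonneg_left zero_le_one)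
  exact ⟨M ^ k, by positivity, fun d => ⟨_, hρ.tensorProd hr.le, fun j hj i =>
    (hρ.integral_abs_partialDeriv_tensorProd_le hM hIM hj i).trans (pow_le_pow_right₀ hM hj)⟩⟩

end ProductMollifier

/-! ### Fooling functions -/

section InfDist

variable {X : Type*} [PseudoMetricSpace X] {K N : Set X} {x y : X} {r ρ : ℝ}

theorem infDist_le_infDist_cthickening_add [ProperSpace X] (hK : K.Nonempty) (hr : 0 ≤ r) (x : X) :
    Metric.infDist x K ≤ Metric.infDist x (Metric.cthickening r K) + r := by
  obtain ⟨w, hw, hxw⟩ := Metric.isClosed_cthickening.exists_infDist_eq_dist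
    (hK.mono (Metric.self_subset_cthickening K)) x
  have hwK : Metric.infDist w K ≤ r := ENNReal.toReal_le_of_le_ofReal hr
    (Metric.mem_cthickening_iff.1 hw)
  rw [hxw]
  linarith [Metric.infDist_le_infDist_add_dist (s := K) (x := x) (y := w)]

theorem abs_infDist_sq_sub_infDist_sq_le (hx : Metric.infDist x N ≤ ρ)
    (hy : Metric.infDist y N ≤ ρ) :
    |Metric.infDist x N ^ 2 - Metric.infDist y N ^ 2| ≤ 2 * ρ * dist x y := by
  rw [sq_sub_sq, abs_mul,
    abs_of_nonneg (add_nonneg Metric.infDist_nonneg Metric.infDist_nonneg), ← Real.dist_eq]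
  have hlip := (Metric.lipschitz_infDist_pt N).dist_le_mul x y
  rw [NNReal.coe_one, one_mul] at hlip
  exact mul_le_mul (by linarith) hlip dist_nonneg
    (mul_nonneg two_pos.le (Metric.infDist_nonneg.trans hx))

theorem continuous_infDist_sq (N : Set X) : Continuous fun x => Metric.infDist x N ^ 2 :=
  (Metric.continuous_infDist_pt N).pow 2

theorem infDist_cthickening_le (hK : K.Nonempty) (hx : Metric.infDist x K ≤ ρ)
    (hy : y ∈ Metric.closedBall x r) : Metric.infDist y (Metric.cthickening r K) ≤ ρ + r :=
  calc Metric.infDist y (Metric.cthickening r K) ≤ Metric.infDist y K :=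
        Metric.infDist_le_infDist_of_subset (Metric.self_subset_cthickening K) hK
    _ ≤ Metric.infDist x K + dist y x := Metric.infDist_le_infDist_add_dist
    _ ≤ ρ + r := add_le_add hx hy

end InfDist

section Fooling

variable {V : Type*} [NormedAddCommGroup V] [MeasureSpace V] {φ : V → ℝ} {r ρ : ℝ}
  {K : Set V} {x y : V}

/-- The fooling function of a set `K`: the squared distance to the closed `r`-neighbourhood of `K`,
convolved with a mollifier `φ` of radius `r`. It vanishes on `K` and is large far from `K`. -/
def fooling (φ : V → ℝ) (r : ℝ) (K : Set V) : V → ℝ :=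
  φ ⋆ fun x => Metric.infDist x (Metric.cthickening r K) ^ 2

variable [NormedSpace ℝ V] [FiniteDimensional ℝ V] [BorelSpace V]
  [(volume : Measure V).IsAddHaarMeasure]

theorem contDiff_fooling (hφ : IsMollifier φ r) (K : Set V) : ContDiff ℝ ∞ (fooling φ r K) :=
  hφ.contDiff_convolution (continuous_infDist_sq _)

theorem fooling_nonneg (hφ : IsMollifier φ r) (x : V) : 0 ≤ fooling φ r K x :=
  hφ.le_convolution (continuous_infDist_sq _) fun _ _ => sq_nonneg _

theorem fooling_eq_zero (hφ : IsMollifier φ r) (hx : x ∈ K) : fooling φ r K x = 0 := by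
  refine (hφ.convolution_le (continuous_infDist_sq _) fun y hy => ?_).antisymm (fooling_nonneg hφ x)
  rw [Metric.infDist_zero_of_mem (Metric.mem_cthickening_of_dist_le y x r K hx hy)]
  norm_num

theorem fooling_le (hφ : IsMollifier φ r) (hK : K.Nonempty) (hx : Metric.infDist x K ≤ ρ) :
    fooling φ r K x ≤ (ρ + r) ^ 2 :=
  hφ.convolution_le (continuous_infDist_sq _) fun _ hy =>
    pow_le_pow_left₀ Metric.infDist_nonneg (infDist_cthickening_le hK hx hy) 2

theorem sq_le_fooling (hφ : IsMollifier φ r) (hK : K.Nonempty) (hr : 0 ≤ r)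
    (hx : x ∉ Metric.cthickening (3 * r) K) : r ^ 2 ≤ fooling φ r K x := by
  refine hφ.le_convolution (continuous_infDist_sq _) fun y hy => pow_le_pow_left₀ hr ?_ 2
  have hfar : 3 * r < Metric.infDist x K := by
    rw [Metric.infDist]
    rw [Metric.cthickening, mem_ofPred_eq, not_le] at hx
    exact (ENNReal.ofReal_lt_iff_lt_toReal (by positivity) (Metric.infEDist_ne_top hK)).1 hx
  have hxy : dist x y ≤ r := dist_comm y x ▸ hy
  linarith [Metric.infDist_le_infDist_add_dist (s := K) (x := x) (y := y),
    infDist_le_infDist_cthickening_add hK hr y]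

theorem abs_fooling_sub_le (hφ : IsMollifier φ r) (hK : K.Nonempty) (hx : Metric.infDist x K ≤ ρ)
    (hy : Metric.infDist y K ≤ ρ) :
    |fooling φ r K x - fooling φ r K y| ≤ 2 * (ρ + r) * ‖x - y‖ := by
  refine hφ.abs_convolution_sub_le (continuous_infDist_sq _) fun t ht => ?_
  have hmem : ∀ z : V, z - t ∈ Metric.closedBall z r := fun z => by simpa using ht
  simpa [dist_eq_norm] using abs_infDist_sq_sub_infDist_sq_le
    (infDist_cthickening_le hK hx (hmem x)) (infDist_cthickening_le hK hy (hmem y))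

theorem half_sq_le_integral_fooling (hφ : IsMollifier φ r) (hK : K.Nonempty) (hr : 0 ≤ r)
    {D : Set V} (hD : MeasurableSet D) (hvol : volume D = 1)
    (hnear : volume.real (D ∩ Metric.cthickening (3 * r) K) ≤ 1 / 2)
    (hint : IntegrableOn (fooling φ r K) D) : r ^ 2 / 2 ≤ ∫ x in D, fooling φ r K x := by
  set S := Metric.cthickening (3 * r) K
  have hS : MeasurableSet S := Metric.isClosed_cthickening.measurableSet
  have hDfin : volume D ≠ ⊤ := by simp [hvol]
  have hfar : 1 / 2 ≤ volume.real (D \ S) := by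
    have hsum := measureReal_inter_add_sdiff (μ := volume) (s := D) hS hDfin
    rw [measureReal_def volume D, hvol, ENNReal.toReal_one] at hsum
    linarith
  calc r ^ 2 / 2 ≤ r ^ 2 * volume.real (D \ S) := by nlinarith [sq_nonneg r]
    _ = ∫ x in D \ S, r ^ 2 := by rw [setIntegral_const, smul_eq_mul, mul_comm]
    _ ≤ ∫ x in D \ S, fooling φ r K x := setIntegral_mono_on
        (integrableOn_const (measure_ne_top_of_subset sdiff_subset hDfin))
        (hint.mono_set sdiff_subset) (hD.diff hS) fun x hx => sq_le_fooling hφ hK hr hx.2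
    _ ≤ ∫ x in D, fooling φ r K x := setIntegral_mono_set hint
        (Eventually.of_forall (fooling_nonneg hφ)) sdiff_subset.eventuallyLE

end Fooling

theorem abs_partialDeriv_succ_fooling_sub_le {d j : ℕ} {φ : E d → ℝ} {r : ℝ} {K : Set (E d)}
    (hφ : IsMollifier φ r) (hK : K.Nonempty) (hconv : Convex ℝ K) (i : Fin (j + 1) → Fin d)
    (x y : E d) :
    |partialDeriv (j + 1) i (fooling φ r K) x - partialDeriv (j + 1) i (fooling φ r K) y| ≤
      2 * ‖x - y‖ * ∫ t, |partialDeriv j (Fin.init i) φ t| := by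
  have hne : (Metric.cthickening r K).Nonempty := hK.mono (Metric.self_subset_cthickening K)
  have hcomplete : IsComplete (Metric.cthickening r K) := Metric.isClosed_cthickening.isComplete
  exact_mod_cast abs_partialDeriv_succ_convolution_sub_le i hφ.contDiff hφ.hasCompactSupport
    (contDiff_infDist_sq hne hcomplete (hconv.cthickening r))
    (lipschitzWith_fderiv_infDist_sq hne hcomplete (hconv.cthickening r)) x y

theorem exists_fooling (k : ℕ) {ε : ℝ} (hε : 0 < ε) (R : ℝ) :
    ∃ C : ℝ, 0 < C ∧ ∀ (d : ℕ) (D : Set (E d)), UnitConvexDomain D (R * √d) →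
      ∀ s ⊆ D, s.Nonempty →
      volume.real (D ∩ Metric.cthickening (3 * (ε * √d)) (convexHull ℝ s)) ≤ 1 / 2 →
      ∃ f : E d → ℝ, ContDiff ℝ ∞ f ∧ (∀ x ∈ s, f x = 0) ∧ (∀ x ∈ D, |f x| ≤ C * d) ∧
        (∀ x ∈ D, ∀ y ∈ D, |f x - f y| ≤ C * √d * ‖x - y‖) ∧
        (∀ j < k, ∀ (i : Fin (j + 1) → Fin d) (x y : E d),
          |partialDeriv (j + 1) i f x - partialDeriv (j + 1) i f y| ≤ C * ‖x - y‖) ∧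
        ε ^ 2 / 2 * d ≤ ∫ x in D, f x := by
  obtain ⟨M, hM, hmoll⟩ := exists_isMollifier_integral_abs_partialDeriv_le k hε
  refine ⟨(R + ε) ^ 2 + 1 + 2 * M, by positivity, fun d D hD s hs hne hnear => ?_⟩
  obtain ⟨φ, hφ, hφM⟩ := hmoll d
  set K := convexHull ℝ s
  have hsK : s ⊆ K := subset_convexHull ℝ s
  have hK : K.Nonempty := hne.mono hsK
  have hsq : √(d : ℝ) ^ 2 = d := Real.sq_sqrt d.cast_nonneg
  obtain ⟨p, hp⟩ := hne
  have hinfDist : ∀ x ∈ D, Metric.infDist x K ≤ R * √d := fun x hx =>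
    (Metric.infDist_le_dist_of_mem (hsK hp)).trans (hD.dist_le x hx p (hs hp))
  have hbound : ∀ x ∈ D, |fooling φ (ε * √d) K x| ≤ ((R + ε) ^ 2 + 1 + 2 * M) * d :=
    fun x hx => by
      rw [abs_of_nonneg (fooling_nonneg hφ x)]
      calc fooling φ (ε * √d) K x ≤ (R * √d + ε * √d) ^ 2 := fooling_le hφ hK (hinfDist x hx)
        _ = (R + ε) ^ 2 * d := by rw [← add_mul, mul_pow, hsq]
        _ ≤ ((R + ε) ^ 2 + 1 + 2 * M) * d := by gcongr; linarith
  refine ⟨fooling φ (ε * √d) K, contDiff_fooling hφ K, fun x hx => fooling_eq_zero hφ (hsK hx),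
    hbound, fun x hx y hy => ?_, fun j hj i x y => ?_, ?_⟩
  · refine (abs_fooling_sub_le hφ hK (hinfDist x hx) (hinfDist y hy)).trans ?_
    rw [← add_mul, ← mul_assoc]
    gcongr
    linarith [two_mul_le_add_sq (R + ε) 1]
  · refine (abs_partialDeriv_succ_fooling_sub_le hφ hK (convex_convexHull ℝ s) i x y).trans ?_
    rw [mul_right_comm]
    gcongr
    linarith [hφM j hj.le (Fin.init i), sq_nonneg (R + ε)]
  · have hDm : MeasurableSet D := hD.isOpen.measurableSet
    have hint : IntegrableOn (fooling φ (ε * √d) K) D :=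
      Measure.integrableOn_of_bounded (by simp [hD.volume_eq_one])
        (contDiff_fooling hφ K).continuous.aestronglyMeasurable
        ((ae_restrict_iff' hDm).2 (Eventually.of_forall hbound))
    have hle := half_sq_le_integral_fooling hφ hK (by positivity) hDm hD.volume_eq_one hnear hint
    rwa [mul_pow, hsq, mul_div_right_comm] at hle

/-! ### The lower bound -/

section PartialClass

variable {d j k : ℕ} {D : Set (E d)} {L : ℕ → ℝ} {f : E d → ℝ}

theorem partialDeriv_neg (i : Fin j → Fin d) (f : E d → ℝ) (x : E d) :
    partialDeriv j i (-f) x = -partialDeriv j i f x := by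
  rw [partialDeriv, iteratedFDeriv_neg_apply]
  rfl

theorem partialDeriv_const_smul (i : Fin j → Fin d) (hf : ContDiff ℝ j f) (c : ℝ) (x : E d) :
    partialDeriv j i (c • f) x = c * partialDeriv j i f x := by
  rw [partialDeriv, iteratedFDeriv_const_smul_apply hf.contDiffAt]
  rfl

theorem neg_mem_partialClass (hf : f ∈ partialClass D k L) : -f ∈ partialClass D k L := by
  refine ⟨hf.1.neg, fun x hx => ?_, fun j hj i x hx y hy => ?_⟩
  · simpa using hf.2.1 x hx
  · rw [partialDeriv_neg, partialDeriv_neg, neg_sub_neg, abs_sub_comm]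
    exact hf.2.2 j hj i x hx y hy

theorem const_smul_mem_partialClass {c : ℝ} (hc : 0 ≤ c) (hf : ContDiff ℝ k f)
    (hbound : ∀ x ∈ D, c * |f x| ≤ 1)
    (hlip : ∀ j ≤ k, ∀ i : Fin j → Fin d, ∀ x ∈ D, ∀ y ∈ D,
      c * |partialDeriv j i f x - partialDeriv j i f y| ≤ L j * ‖x - y‖) :
    c • f ∈ partialClass D k L := by
  refine ⟨(hf.const_smul c).contDiffOn, fun x hx => ?_, fun j hj i x hx y hy => ?_⟩
  · simpa [abs_mul, abs_of_nonneg hc] using hbound x hx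
  · have hfj : ContDiff ℝ j f := hf.of_le (by exact_mod_cast hj)
    rw [partialDeriv_const_smul i hfj, partialDeriv_const_smul i hfj, ← mul_sub, abs_mul,
      abs_of_nonneg hc]
    exact hlip j hj i x hx y hy

end PartialClass

theorem exists_fooling_mem_partialClass (k : ℕ) {ε δ : ℝ} (hε : 0 < ε) (hδ : 0 < δ) (R : ℝ) :
    ∃ η : ℝ, 0 < η ∧ ∀ d : ℕ, 1 ≤ d → ∀ (D : Set (E d)) (L : ℕ → ℝ),
      UnitConvexDomain D (R * √d) → δ ≤ L 0 * √d → (∀ j < k, δ ≤ L (j + 1) * d) →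
      ∀ s ⊆ D, s.Nonempty →
      volume.real (D ∩ Metric.cthickening (3 * (ε * √d)) (convexHull ℝ s)) ≤ 1 / 2 →
      ∃ f ∈ partialClass D k L, (∀ x ∈ s, f x = 0) ∧ η ≤ ∫ x in D, f x := by
  obtain ⟨C, hC, hfool⟩ := exists_fooling k hε R
  set a := min δ 1 / C
  have ha : 0 < a := by positivity
  have haC : a * C = min δ 1 := div_mul_cancel₀ _ hC.ne'
  have haC_one : a * C ≤ 1 := haC.trans_le (min_le_right _ _)
  have haC_le : a * C ≤ δ := haC.trans_le (min_le_left _ _)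
  refine ⟨a * (ε ^ 2 / 2), by positivity, fun d hd D L hD hL₀ hL s hs hne hnear => ?_⟩
  have hd0 : (0 : ℝ) < d := by exact_mod_cast hd
  obtain ⟨f, hf, hfs, hbound, hlip, hlip_succ, hint⟩ := hfool d D hD s hs hne hnear
  refine ⟨(a / d) • f, const_smul_mem_partialClass (by positivity)
    (hf.of_le (by exact_mod_cast le_top)) (fun x hx => ?_) fun j hj i x hx y hy => ?_,
    fun x hx => by simp [hfs x hx], ?_⟩
  · calc a / d * |f x| ≤ a / d * (C * d) := by gcongr; exact hbound x hx
      _ = a * C := by field_simp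
      _ ≤ 1 := haC_one
  · rcases j with _ | j
    · simp_rw [partialDeriv_zero]
      calc a / d * |f x - f y| ≤ a / d * (C * √d * ‖x - y‖) := by gcongr; exact hlip x hx y hy
        _ = a * C * (√d / d) * ‖x - y‖ := by ring
        _ = a * C / √d * ‖x - y‖ := by rw [Real.sqrt_div_self', mul_one_div]
        _ ≤ L 0 * ‖x - y‖ := by
          gcongr
          exact (div_le_iff₀ (by positivity)).2 (haC_le.trans hL₀)
    · calc a / d * |partialDeriv (j + 1) i f x - partialDeriv (j + 1) i f y|
          ≤ a / d * (C * ‖x - y‖) := by gcongr; exact hlip_succ j hj i x y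
        _ = a * C / d * ‖x - y‖ := by ring
        _ ≤ L (j + 1) * ‖x - y‖ := by
          gcongr
          exact (div_le_iff₀ hd0).2 (haC_le.trans (hL j hj))
  · simp only [Pi.smul_apply, smul_eq_mul, integral_const_mul]
    calc a * (ε ^ 2 / 2) = a / d * (ε ^ 2 / 2 * d) := by field_simp
      _ ≤ a / d * ∫ x in D, f x := by gcongr

section Algorithm

variable {d : ℕ} {D : Set (E d)} {F : Set (E d → ℝ)} {ε : ℝ}

theorem Algorithm.values_congr (A : Algorithm D) {f g : E d → ℝ} {n : ℕ}
    (h : ∀ m < n, f (A.node (A.values g m)) = g (A.node (A.values g m))) :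
    A.values f n = A.values g n := by
  induction n with
  | zero => rfl
  | succ n ih =>
    rw [Algorithm.values, Algorithm.values, ih fun m hm => h m (hm.trans n.lt_succ_self),
      h n n.lt_succ_self]

theorem Algorithm.integral_le_of_errorLE {A : Algorithm D} {n : ℕ} (hA : A.ErrorLE n F ε)
    {f : E d → ℝ} (hf : f ∈ F) (hneg : -f ∈ F)
    (hzero : ∀ m < n, f (A.node (A.values 0 m)) = 0) : ∫ x in D, f x ≤ ε := by
  have hrun : A.run n f = A.run n 0 := congrArg A.output (A.values_congr hzero)
  have hrun_neg : A.run n (-f) = A.run n 0 :=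
    congrArg A.output (A.values_congr fun m hm => by simp [hzero m hm])
  have herr := (abs_le.1 (hA f hf)).2
  have herr_neg := (abs_le.1 (hA (-f) hneg)).1
  simp only [Pi.neg_apply, integral_neg] at herr_neg
  linarith

theorem ofReal_le_infoComplexity {r : ℝ}
    (h : ∀ (n : ℕ) (A : Algorithm D), A.ErrorLE n F ε → r ≤ n) :
    ENNReal.ofReal r ≤ ((infoComplexity D F ε : ℕ∞) : ℝ≥0∞) := by
  have hceil : ((⌈r⌉₊ : ℕ) : ℕ∞) ≤ infoComplexity D F ε :=
    le_iInf₂ fun n ⟨A, hA⟩ => by exact_mod_cast Nat.ceil_le.2 (h n A hA)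
  calc ENNReal.ofReal r ≤ ENNReal.ofReal ⌈r⌉₊ := ENNReal.ofReal_le_ofReal (Nat.le_ceil r)
    _ = ((⌈r⌉₊ : ℕ∞) : ℝ≥0∞) := by simp
    _ ≤ ((infoComplexity D F ε : ℕ∞) : ℝ≥0∞) := ENat.toENNReal_le.2 hceil

theorem ofReal_sub_one_le_infoComplexity_of_fooling {N : ℝ}
    (h : ∀ s : Finset (E d), ↑s ⊆ D → s.Nonempty → s.card ≤ N →
      ∃ f ∈ F, -f ∈ F ∧ (∀ x ∈ s, f x = 0) ∧ ε < ∫ x in D, f x) :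
    ENNReal.ofReal (N - 1) ≤ ((infoComplexity D F ε : ℕ∞) : ℝ≥0∞) := by
  classical
  refine ofReal_le_infoComplexity fun n A hA => ?_
  by_contra! hn
  set s : Finset (E d) := (Finset.range (n + 1)).image fun m => A.node (A.values 0 m)
  have hs : ↑s ⊆ D := by
    simp only [s, Finset.coe_image, image_subset_iff]
    exact fun m _ => A.node_mem _
  have hcard : (s.card : ℝ) ≤ n + 1 := by
    exact_mod_cast Finset.card_image_le.trans (Finset.card_range _).le
  obtain ⟨f, hf, hneg, hzero, hlt⟩ := h s hs (by simp [s]) (by linarith)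
  exact hlt.not_ge (Algorithm.integral_le_of_errorLE hA hf hneg fun m hm =>
    hzero _ (Finset.mem_image_of_mem _ (Finset.mem_range.2 (by omega))))

end Algorithm

theorem curseOfDimensionality_partialClass {D : ∀ d : ℕ, Set (E d)} {k : ℕ} {L : ℕ → ℕ → ℝ}
    {R δ : ℝ} (hD : ∀ᶠ d in atTop, UnitConvexDomain (D d) (R * √d)) (hhull : SmallHullNhds D)
    (hδ : 0 < δ)
    (hL : ∃ᶠ d : ℕ in atTop, δ ≤ L 0 d * √d ∧ ∀ j < k, δ ≤ L (j + 1) d * d) :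
    CurseOfDimensionality D fun d => partialClass (D d) k fun j => L j d := by
  obtain ⟨ε, q, hε, hq, hq_one, hnhds⟩ := hhull
  obtain ⟨η, hη, hfool⟩ := exists_fooling_mem_partialClass k (by positivity : 0 < ε / 3) hδ R
  have hq_inv : 1 < q⁻¹ := (one_lt_inv₀ hq).2 hq_one
  refine ⟨1 / 4, η / 2, q⁻¹ - 1, by norm_num, by positivity, by linarith, fun e _ he => ?_⟩
  have hlarge : ∀ᶠ d : ℕ in atTop, 4 ≤ q⁻¹ ^ d :=
    (tendsto_pow_atTop_atTop_of_one_lt hq_inv).eventually_ge_atTop 4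
  refine (hL.and_eventually (hD.and (hnhds.and (hlarge.and (eventually_ge_atTop 1))))).mono ?_
  rintro d ⟨⟨hL₀, hL_succ⟩, hDd, hhulld, hd_large, hd⟩
  refine (ENNReal.ofReal_le_ofReal ?_).trans
    (ofReal_sub_one_le_infoComplexity_of_fooling (N := 1 / 2 * q⁻¹ ^ d) fun s hs hne hcard => ?_)
  · rw [add_sub_cancel]
    linarith
  · have hnear : volume.real (D d ∩ Metric.cthickening (3 * (ε / 3 * √d)) (convexHull ℝ ↑s))
        ≤ 1 / 2 :=
      calc _ ≤ s.card * q ^ d := by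
            rw [show 3 * (ε / 3 * √d) = ε * √d by ring]
            exact hhulld s hs
        _ ≤ 1 / 2 * q⁻¹ ^ d * q ^ d := by gcongr
        _ = 1 / 2 := by rw [mul_assoc, ← mul_pow, inv_mul_cancel₀ hq.ne', one_pow, mul_one]
    obtain ⟨f, hf, hfs, hint⟩ := hfool d hd (D d) (fun j => L j d) hDd hL₀ hL_succ s hs hne hnear
    exact ⟨f, hf, neg_mem_partialClass hf, hfs, by linarith⟩

theorem exists_frequently_of_limsup_pos {k : ℕ} {L : ℕ → ℕ → ℝ}
    (h : 0 < limsup (fun d : ℕ => min ((L 0 d * √d : ℝ) : EReal)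
      (⨅ j ∈ Finset.Icc 1 k, ((L j d * (d : ℝ) : ℝ) : EReal))) atTop) :
    ∃ δ : ℝ, 0 < δ ∧ ∃ᶠ d : ℕ in atTop, δ ≤ L 0 d * √d ∧ ∀ j < k, δ ≤ L (j + 1) d * d := by
  obtain ⟨δ, hδ, hlt⟩ := EReal.lt_iff_exists_real_btwn.1 h
  refine ⟨δ, by exact_mod_cast hδ, (frequently_lt_of_lt_limsup (by isBoundedDefault) hlt).mono
    fun d hd => ?_⟩
  obtain ⟨h₀, h_iInf⟩ := lt_min_iff.1 hd
  refine ⟨by exact_mod_cast h₀.le, fun j hj => ?_⟩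
  have hle := h_iInf.le.trans (iInf₂_le (j + 1) (Finset.mem_Icc.2 ⟨by omega, by omega⟩))
  exact_mod_cast hle

/-! ### Taylor polynomials -/

theorem norm_sub_sum_iteratedFDeriv_le {V W : Type*} [NormedAddCommGroup V] [NormedSpace ℝ V]
    [NormedAddCommGroup W] [NormedSpace ℝ W] [CompleteSpace W] {f : V → W} {x y : V} {n : ℕ}
    {B : ℝ} (hf : ∀ t ∈ Icc (0 : ℝ) 1, ContDiffAt ℝ (n + 1) f (x + t • y))
    (hB : ∀ t ∈ Icc (0 : ℝ) 1, ‖iteratedFDeriv ℝ (n + 1) f (x + t • y) (fun _ => y) -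
      iteratedFDeriv ℝ (n + 1) f x (fun _ => y)‖ ≤ B) :
    ‖f (x + y) - ∑ m ∈ Finset.range (n + 2),
      (m.factorial : ℝ)⁻¹ • iteratedFDeriv ℝ m f x (fun _ => y)‖ ≤
      ((n + 1).factorial : ℝ)⁻¹ * B := by
  set φ : ℝ → W := fun t => iteratedFDeriv ℝ (n + 1) f (x + t • y) fun _ => y with hφ
  have hφ_cont : ContinuousOn φ (uIcc 0 1) := fun t ht => by
    rw [uIcc_of_le zero_le_one] at ht
    have hcont : ContinuousAt (iteratedFDeriv ℝ (n + 1) f) (x + t • y) :=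
      ((hf t ht).iteratedFDeriv_right (i := n + 1) (m := 0) (by simp)).continuousAt
    exact (hcont.comp (x := t) (by fun_prop)).continuousWithinAt.eval_const _
  have hpow : ∫ t in (0 : ℝ)..1, (1 - t) ^ n = ((n : ℝ) + 1)⁻¹ := by
    rw [intervalIntegral.integral_comp_sub_left (fun t => t ^ n) 1, integral_pow]
    simp
  have hfact : ((n + 1).factorial : ℝ)⁻¹ = (n.factorial : ℝ)⁻¹ * ((n : ℝ) + 1)⁻¹ := by
    rw [Nat.factorial_succ, Nat.cast_mul, Nat.cast_succ, mul_inv_rev]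
  have hrem : f (x + y) - ∑ m ∈ Finset.range (n + 2),
      (m.factorial : ℝ)⁻¹ • iteratedFDeriv ℝ m f x (fun _ => y) =
      (n.factorial : ℝ)⁻¹ • ∫ t in (0 : ℝ)..1, (1 - t) ^ n • (φ t - φ 0) := by
    simp_rw [smul_sub]
    rw [intervalIntegral.integral_sub (ContinuousOn.intervalIntegrable (by fun_prop))
      (ContinuousOn.intervalIntegrable (by fun_prop)), intervalIntegral.integral_smul_const, hpow,
      map_add_eq_sum_add_integral_iteratedFDeriv hf, Finset.sum_range_succ _ (n + 1), hfact,
      smul_sub, mul_smul]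
    simp only [hφ, zero_smul, add_zero]
    abel
  have hint : ‖∫ t in (0 : ℝ)..1, (1 - t) ^ n • (φ t - φ 0)‖ ≤ ((n : ℝ) + 1)⁻¹ * B := by
    rw [← hpow, ← intervalIntegral.integral_mul_const]
    refine intervalIntegral.norm_integral_le_of_norm_le zero_le_one
      (Eventually.of_forall fun t ht => ?_) (Continuous.intervalIntegrable (by fun_prop) _ _)
    have ht_pow : 0 ≤ (1 - t) ^ n := pow_nonneg (sub_nonneg.2 ht.2) n
    rw [norm_smul, Real.norm_of_nonneg ht_pow]
    gcongr
    simpa [hφ] using hB t ⟨ht.1.le, ht.2⟩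
  rw [hrem, norm_smul, Real.norm_of_nonneg (by positivity), hfact, mul_assoc]
  gcongr

section Taylor

variable {d j k : ℕ} {D : Set (E d)} {L : ℕ → ℝ} {f : E d → ℝ}

/-- Index set of the monomials of degree at most `j` in `d` variables. Several indices give the
same monomial, since the order in which the variables are multiplied is recorded. -/
abbrev TaylorIndex (d j : ℕ) : Type := Σ m : Fin (j + 1), Fin m → Fin d

/-- The monomial with index `a` in the coordinates of `x - z`. -/
def taylorMonomial (z x : E d) (a : TaylorIndex d j) : ℝ := ∏ l, (x - z) (a.2 l)

/-- The coefficient of `taylorMonomial z x a` in the Taylor polynomial of `f` at `z`. -/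
def taylorCoeff (f : E d → ℝ) (z : E d) (a : TaylorIndex d j) : ℝ :=
  ((a.1 : ℕ).factorial : ℝ)⁻¹ * partialDeriv a.1 a.2 f z

theorem card_taylorIndex_le (hd : 1 ≤ d) (j : ℕ) :
    Fintype.card (TaylorIndex d j) ≤ (j + 1) * d ^ j := by
  rw [Fintype.card_sigma]
  refine (Finset.sum_le_card_nsmul _ _ (d ^ j) fun m _ => ?_).trans (by simp)
  rw [Fintype.card_fun, Fintype.card_fin, Fintype.card_fin]
  exact Nat.pow_le_pow_right hd (Nat.lt_succ_iff.1 m.2)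

theorem continuous_taylorMonomial (z : E d) :
    Continuous (taylorMonomial z : E d → TaylorIndex d j → ℝ) := by
  unfold taylorMonomial
  fun_prop

theorem iteratedFDeriv_apply_eq_sum_partialDeriv (f : E d → ℝ) (x v : E d) :
    iteratedFDeriv ℝ j f x (fun _ => v) =
      ∑ i : Fin j → Fin d, (∏ l, v (i l)) * partialDeriv j i f x := by
  have hv : v = ∑ a, v a • EuclideanSpace.single a (1 : ℝ) := by
    ext b
    simp [Finset.sum_apply, Pi.single_apply]
  conv_lhs => rw [hv]
  rw [ContinuousMultilinearMap.map_sum]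
  refine Finset.sum_congr rfl fun i _ => ?_
  rw [ContinuousMultilinearMap.map_smul_univ, smul_eq_mul, partialDeriv]

theorem sum_taylorCoeff_mul_taylorMonomial (j : ℕ) (f : E d → ℝ) (z x : E d) :
    ∑ a : TaylorIndex d j, taylorCoeff f z a * taylorMonomial z x a =
      ∑ m ∈ Finset.range (j + 1),
        (m.factorial : ℝ)⁻¹ * iteratedFDeriv ℝ m f z (fun _ => x - z) := by
  rw [Fintype.sum_sigma, ← Fin.sum_univ_eq_sum_range fun m =>
    (m.factorial : ℝ)⁻¹ * iteratedFDeriv ℝ m f z (fun _ => x - z)]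
  refine Finset.sum_congr rfl fun m _ => ?_
  rw [iteratedFDeriv_apply_eq_sum_partialDeriv, Finset.mul_sum]
  refine Finset.sum_congr rfl fun i _ => ?_
  rw [taylorCoeff, taylorMonomial]
  ring

theorem sum_abs_le_sqrt_mul_norm (v : E d) : ∑ a, |v a| ≤ √d * ‖v‖ := by
  refine le_of_sq_le_sq ?_ (by positivity)
  rw [mul_pow, Real.sq_sqrt d.cast_nonneg, EuclideanSpace.norm_sq_eq]
  simpa using sq_sum_le_card_mul_sum_sq (s := Finset.univ) (f := fun a => |v a|)

theorem abs_iteratedFDeriv_sub_le {x y v : E d} {B : ℝ} (hB : 0 ≤ B)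
    (h : ∀ i : Fin j → Fin d, |partialDeriv j i f x - partialDeriv j i f y| ≤ B) :
    |iteratedFDeriv ℝ j f x (fun _ => v) - iteratedFDeriv ℝ j f y (fun _ => v)| ≤
      (√d * ‖v‖) ^ j * B := by
  simp_rw [iteratedFDeriv_apply_eq_sum_partialDeriv, ← Finset.sum_sub_distrib, ← mul_sub]
  calc |∑ i : Fin j → Fin d, (∏ l, v (i l)) * (partialDeriv j i f x - partialDeriv j i f y)|
      ≤ ∑ i : Fin j → Fin d, |(∏ l, v (i l)) * (partialDeriv j i f x - partialDeriv j i f y)| :=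
        Finset.abs_sum_le_sum_abs _ _
    _ ≤ ∑ i : Fin j → Fin d, (∏ l, |v (i l)|) * B := by
        gcongr with i
        rw [abs_mul, Finset.abs_prod]
        gcongr
        exact h i
    _ = (∑ a, |v a|) ^ j * B := by rw [← Finset.sum_mul, Finset.sum_pow', Fintype.piFinset_univ]
    _ ≤ (√d * ‖v‖) ^ j * B := by
        gcongr
        exact sum_abs_le_sqrt_mul_norm v

theorem contDiffAt_of_mem_partialClass (hD : IsOpen D) (hf : f ∈ partialClass D k L) {x : E d}
    (hx : x ∈ D) (hj : j ≤ k) : ContDiffAt ℝ j f x :=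
  (hf.1.contDiffAt (hD.mem_nhds hx)).of_le (by exact_mod_cast hj)

theorem abs_sub_taylor_le (hD : IsOpen D) (hconv : Convex ℝ D) (hf : f ∈ partialClass D k L)
    (hj : j ≤ k) (hL : 0 ≤ L j) {z x : E d} (hz : z ∈ D) (hx : x ∈ D) :
    |f x - ∑ a : TaylorIndex d j, taylorCoeff f z a * taylorMonomial z x a| ≤
      (√d * ‖x - z‖) ^ j * (L j * ‖x - z‖) := by
  rw [sum_taylorCoeff_mul_taylorMonomial]
  rcases j with _ | n
  · simpa [partialDeriv_zero] using hf.2.2 0 hj Fin.elim0 x hx z hz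
  have hseg : ∀ t ∈ Icc (0 : ℝ) 1, z + t • (x - z) ∈ D := fun t ht =>
    hconv.add_smul_sub_mem hz hx ht
  have hlip : ∀ t ∈ Icc (0 : ℝ) 1,
      |iteratedFDeriv ℝ (n + 1) f (z + t • (x - z)) (fun _ => x - z) -
        iteratedFDeriv ℝ (n + 1) f z (fun _ => x - z)| ≤
        (√d * ‖x - z‖) ^ (n + 1) * (L (n + 1) * ‖x - z‖) := fun t ht =>
    abs_iteratedFDeriv_sub_le (by positivity) fun i => by
      refine (hf.2.2 (n + 1) hj i _ (hseg t ht) z hz).trans ?_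
      gcongr
      rw [add_sub_cancel_left, norm_smul, Real.norm_of_nonneg ht.1]
      exact mul_le_of_le_one_left (norm_nonneg _) ht.2
  have htaylor := norm_sub_sum_iteratedFDeriv_le (f := f) (x := z) (y := x - z) (n := n)
    (fun t ht => by
      exact_mod_cast contDiffAt_of_mem_partialClass hD hf (hseg t ht) hj) hlip
  rw [add_sub_cancel] at htaylor
  refine htaylor.trans (mul_le_of_le_one_left (by positivity) ?_)
  exact inv_le_one_of_one_le₀ (by exact_mod_cast (n + 1).factorial_pos)

theorem abs_partialDeriv_succ_le (hD : IsOpen D) (hf : f ∈ partialClass D k L) (hj : j < k)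
    (hL : 0 ≤ L j) (i : Fin (j + 1) → Fin d) {z : E d} (hz : z ∈ D) :
    |partialDeriv (j + 1) i f z| ≤ L j := by
  have hdiff : DifferentiableAt ℝ (iteratedFDeriv ℝ j f) z :=
    (contDiffAt_of_mem_partialClass hD hf hz hj).differentiableAt_iteratedFDeriv
      (by exact_mod_cast j.lt_succ_self)
  have heq : partialDeriv (j + 1) i f z =
      fderiv ℝ (partialDeriv j (Fin.tail i) f) z (EuclideanSpace.single (i 0) 1) :=
    hdiff.iteratedFDeriv_succ_apply_left'
  have hnorm : ‖fderiv ℝ (partialDeriv j (Fin.tail i) f) z‖ ≤ L j := by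
    refine norm_fderiv_le_of_lip' ℝ hL ?_
    filter_upwards [hD.mem_nhds hz] with x hx
    exact hf.2.2 j hj.le _ x hx z hz
  rw [heq, ← Real.norm_eq_abs]
  exact (ContinuousLinearMap.le_opNorm _ _).trans (by simpa using hnorm)

theorem abs_taylorCoeff_le (hD : IsOpen D) (hf : f ∈ partialClass D k L) (hj : j ≤ k)
    (hL : ∀ m < j, 0 ≤ L m) {z : E d} (hz : z ∈ D) (a : TaylorIndex d j) :
    |taylorCoeff f z a| ≤ 1 + ∑ m ∈ Finset.range j, L m := by
  have hL' : ∀ m ∈ Finset.range j, 0 ≤ L m := fun m hm => hL m (Finset.mem_range.1 hm)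
  obtain ⟨⟨m, hm⟩, i⟩ := a
  have hderiv : |partialDeriv m i f z| ≤ 1 + ∑ m ∈ Finset.range j, L m := by
    rcases m with _ | m
    · rw [partialDeriv_zero]
      linarith [hf.2.1 z hz, Finset.sum_nonneg hL']
    · have hmj : m < j := Nat.lt_of_succ_lt_succ hm
      linarith [abs_partialDeriv_succ_le hD hf (hmj.trans_le hj) (hL m hmj) i hz,
        Finset.single_le_sum hL' (Finset.mem_range.2 hmj)]
  rw [taylorCoeff, abs_mul, abs_of_nonneg (by positivity)]
  refine (mul_le_of_le_one_left (abs_nonneg _) ?_).trans hderiv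
  exact inv_le_one_of_one_le₀ (by exact_mod_cast m.factorial_pos)

end Taylor

/-! ### The upper bound -/

theorem Algorithm.length_values {d : ℕ} {D : Set (E d)} (A : Algorithm D) (f : E d → ℝ) (n : ℕ) :
    (A.values f n).length = n := by
  induction n with
  | zero => rfl
  | succ n ih => simp [Algorithm.values, ih]

theorem Algorithm.getD_values {d : ℕ} {D : Set (E d)} (A : Algorithm D) (f : E d → ℝ) {m n : ℕ}
    (h : m < n) : (A.values f n).getD m 0 = f (A.node (A.values f m)) := by
  induction n, h using Nat.le_induction with
  | base => simp [Algorithm.values, A.length_values]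
  | succ n hmn ih =>
    rw [Algorithm.values, List.getD_append _ _ _ _ (by rwa [A.length_values]), ih]

theorem exists_algorithm_run_eq_sum {d n : ℕ} {D : Set (E d)} (hD : D.Nonempty)
    {p : Fin n → E d} (hp : ∀ m, p m ∈ D) (w : Fin n → ℝ) :
    ∃ A : Algorithm D, ∀ f, A.run n f = ∑ m, w m * f (p m) := by
  obtain ⟨z, hz⟩ := hD
  let A : Algorithm D :=
    { node := fun v => if h : v.length < n then p ⟨v.length, h⟩ else z
      node_mem := fun v => by
        split_ifs
        · exact hp _
        · exact hz
      output := fun v => ∑ m : Fin n, w m * v.getD m 0 }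
  refine ⟨A, fun f => ?_⟩
  change ∑ m : Fin n, w m * (A.values f n).getD m 0 = _
  refine Finset.sum_congr rfl fun m _ => ?_
  rw [A.getD_values f m.2]
  simp [A, Algorithm.length_values]

section Cubature

variable {d : ℕ} {D : Set (E d)} {ι : Type*} [Fintype ι] {Φ : E d → ι → ℝ}

/-- The barycentre of `Φ` lies in the closure of the convex hull of its values, so by
Carathéodory's theorem it is approximated by convex combinations of few of them. -/
theorem exists_cubature (hDm : MeasurableSet D) (hvol : volume D = 1) (hΦ : IntegrableOn Φ D)
    {τ : ℝ} (hτ : 0 < τ) :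
    ∃ n ≤ Fintype.card ι + 1, ∃ (p : Fin n → E d) (w : Fin n → ℝ), (∀ m, p m ∈ D) ∧
      (∀ m, 0 ≤ w m) ∧ ∑ m, w m = 1 ∧
      ∀ a, |(∫ x in D, Φ x a) - ∑ m, w m * Φ (p m) a| ≤ τ := by
  have : IsProbabilityMeasure (volume.restrict D) := ⟨by simpa using hvol⟩
  have hmem : ∫ x in D, Φ x ∈ closure (convexHull ℝ (Φ '' D)) := by
    refine (convex_convexHull ℝ _).closure.integral_mem isClosed_closure ?_ hΦ
    refine (ae_restrict_iff' hDm).2 (Eventually.of_forall fun x hx => ?_)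
    exact subset_closure (subset_convexHull ℝ _ (mem_image_of_mem _ hx))
  obtain ⟨y, hy, hdist⟩ := Metric.mem_closure_iff.1 hmem τ hτ
  obtain ⟨κ, _, z, w, hz, hindep, hw, hw_sum, hwz⟩ := eq_pos_convex_span_of_mem_convexHull hy
  have hcard : Fintype.card κ ≤ Fintype.card ι + 1 := by
    refine hindep.card_le_finrank_succ.trans ?_
    gcongr
    exact (Submodule.finrank_le _).trans_eq (by simp)
  choose p hpD hpz using fun a => hz (mem_range_self a)
  let e := (Fintype.equivFin κ).symm
  refine ⟨Fintype.card κ, hcard, p ∘ e, w ∘ e, fun m => hpD _, fun m => (hw _).le,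
    (e.sum_comp w).trans hw_sum, fun a => ?_⟩
  have hy_apply : ∑ m, w (e m) * Φ (p (e m)) a = y a := by
    rw [← hwz, e.sum_comp fun b => w b * Φ (p b) a, Finset.sum_apply]
    exact Finset.sum_congr rfl fun b _ => by rw [hpz]; rfl
  have hint_apply : ∫ x in D, Φ x a = (∫ x in D, Φ x) a :=
    (eval_integral (fun i => hΦ.eval i) a).symm
  rw [hint_apply, ← Real.dist_eq]
  exact hy_apply ▸ (dist_le_pi_dist _ _ a).trans hdist.le

theorem abs_integral_sum_sub_cubature_le (hΦ : IntegrableOn Φ D) {n : ℕ} {p : Fin n → E d}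
    {w : Fin n → ℝ} {τ : ℝ} (h : ∀ a, |(∫ x in D, Φ x a) - ∑ m, w m * Φ (p m) a| ≤ τ)
    (c : ι → ℝ) :
    |(∫ x in D, ∑ a, c a * Φ x a) - ∑ m, w m * ∑ a, c a * Φ (p m) a| ≤ (∑ a, |c a|) * τ := by
  have heq : (∫ x in D, ∑ a, c a * Φ x a) - ∑ m, w m * ∑ a, c a * Φ (p m) a =
      ∑ a, c a * ((∫ x in D, Φ x a) - ∑ m, w m * Φ (p m) a) := by
    rw [integral_finsetSum _ fun a _ => (hΦ.eval a).const_mul _]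
    simp_rw [integral_const_mul, mul_sub, Finset.sum_sub_distrib, Finset.mul_sum, mul_left_comm]
    rw [Finset.sum_comm]
  rw [heq, Finset.sum_mul]
  refine (Finset.abs_sum_le_sum_abs _ _).trans (Finset.sum_le_sum fun a _ => ?_)
  rw [abs_mul]
  gcongr
  exact h a

theorem abs_sum_sub_sum_le_of_convexWeights {n : ℕ} {p : Fin n → E d} (hp : ∀ m, p m ∈ D)
    {w : Fin n → ℝ} (hw : ∀ m, 0 ≤ w m) (hw_sum : ∑ m, w m = 1) {f g : E d → ℝ} {B : ℝ}
    (h : ∀ x ∈ D, |f x - g x| ≤ B) :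
    |∑ m, w m * f (p m) - ∑ m, w m * g (p m)| ≤ B := by
  rw [← Finset.sum_sub_distrib]
  calc |∑ m, (w m * f (p m) - w m * g (p m))|
      ≤ ∑ m, |w m * f (p m) - w m * g (p m)| := Finset.abs_sum_le_sum_abs _ _
    _ ≤ ∑ m, w m * B := Finset.sum_le_sum fun m _ => by
        rw [← mul_sub, abs_mul, abs_of_nonneg (hw m)]
        exact mul_le_mul_of_nonneg_left (h _ (hp m)) (hw m)
    _ = B := by rw [← Finset.sum_mul, hw_sum, one_mul]

theorem infoComplexity_le_of_approx (hDm : MeasurableSet D) (hvol : volume D = 1)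
    (hΦ : IntegrableOn Φ D) {F : Set (E d → ℝ)} {B M : ℝ} (hB : 0 < B) (hM : 0 < M)
    (hF : ∀ f ∈ F, IntegrableOn f D) (happrox : ∀ f ∈ F, ∃ c : ι → ℝ, ∑ a, |c a| ≤ M ∧
      ∀ x ∈ D, |f x - ∑ a, c a * Φ x a| ≤ B) :
    infoComplexity D F (3 * B) ≤ ((Fintype.card ι + 1 : ℕ) : ℕ∞) := by
  obtain ⟨n, hn, p, w, hp, hw, hw_sum, hcub⟩ :=
    exists_cubature hDm hvol hΦ (div_pos hB hM)
  have hne : D.Nonempty := nonempty_of_measure_ne_zero (μ := volume) (by simp [hvol])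
  obtain ⟨A, hA⟩ := exists_algorithm_run_eq_sum hne hp w
  refine (iInf₂_le n ⟨A, fun f hf => ?_⟩).trans (by exact_mod_cast hn)
  obtain ⟨c, hc, hfc⟩ := happrox f hf
  rw [hA]
  have hint : |(∫ x in D, f x) - ∫ x in D, ∑ a, c a * Φ x a| ≤ B := by
    rw [← integral_sub (hF f hf) (integrable_finsetSum _ fun a _ => (hΦ.eval a).const_mul _)]
    simpa [measureReal_def, hvol] using norm_setIntegral_le_of_norm_le_const
      (f := fun x => f x - ∑ a, c a * Φ x a) (by simp [hvol] : volume D < ⊤) hfc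
  have hcub_sum : |(∫ x in D, ∑ a, c a * Φ x a) - ∑ m, w m * ∑ a, c a * Φ (p m) a| ≤ B :=
    calc _ ≤ (∑ a, |c a|) * (B / M) := abs_integral_sum_sub_cubature_le hΦ hcub c
      _ ≤ M * (B / M) := by gcongr
      _ = B := mul_div_cancel₀ _ hM.ne'
  have hnodes := abs_sum_sub_sum_le_of_convexWeights hp hw hw_sum hfc
  rw [abs_le] at *
  constructor <;> linarith

end Cubature

theorem infoComplexity_partialClass_le {d j k : ℕ} (hd : 1 ≤ d) {D : Set (E d)} {R : ℝ}
    (hD : UnitConvexDomain D R) {L : ℕ → ℝ} (hj : j ≤ k) (hL : ∀ m ≤ j, 0 ≤ L m) {B : ℝ}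
    (hB : 0 < B) (hRB : (√d * R) ^ j * (L j * R) ≤ B) :
    infoComplexity D (partialClass D k L) (3 * B) ≤ (((j + 1) * d ^ j + 1 : ℕ) : ℕ∞) := by
  have hDm : MeasurableSet D := hD.isOpen.measurableSet
  have hfin : IsFiniteMeasure (volume.restrict D) := ⟨by simp [hD.volume_eq_one]⟩
  obtain ⟨z, hz⟩ := hD.nonempty
  have hint : IntegrableOn (taylorMonomial z : E d → TaylorIndex d j → ℝ) D :=
    ((continuous_taylorMonomial z).continuousOn.integrableOn_compact
      (isCompact_closedBall z R)).mono_set fun x hx => hD.dist_le x hx z hz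
  set M : ℝ := 1 + ∑ m ∈ Finset.range j, L m
  have hM : 0 < M := add_pos_of_pos_of_nonneg one_pos
    (Finset.sum_nonneg fun m hm => hL m (Finset.mem_range.1 hm).le)
  refine (infoComplexity_le_of_approx hDm hD.volume_eq_one hint hB
    (by positivity : 0 < (Fintype.card (TaylorIndex d j) + 1) * M) (fun f hf => ?_)
    fun f hf => ⟨taylorCoeff f z, ?_, fun x hx => ?_⟩).trans
    (by exact_mod_cast Nat.succ_le_succ (card_taylorIndex_le hd j))
  · exact Integrable.of_bound (hf.1.continuousOn.aestronglyMeasurable hDm) 1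
      ((ae_restrict_iff' hDm).2 (Eventually.of_forall hf.2.1))
  · refine (Finset.sum_le_card_nsmul _ _ M fun a _ =>
      abs_taylorCoeff_le hD.isOpen hf hj (fun m hm => hL m hm.le) hz a).trans ?_
    rw [nsmul_eq_mul, Finset.card_univ]
    gcongr
    exact le_add_of_nonneg_right zero_le_one
  · have hLj : 0 ≤ L j := hL j le_rfl
    have hxz : ‖x - z‖ ≤ R := (dist_eq_norm x z).symm.trans_le (hD.dist_le x hx z hz)
    have hR : 0 ≤ R := (norm_nonneg _).trans hxz
    refine (abs_sub_taylor_le hD.isOpen hD.convex hf hj hLj hz hx).trans (le_trans ?_ hRB)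
    gcongr

theorem tendsto_poly_div_pow_atTop (j : ℕ) {b : ℝ} (hb : 1 < b) :
    Tendsto (fun d : ℕ => ((j + 1) * (d : ℝ) ^ j + 1) / b ^ d) atTop (𝓝 0) := by
  have hpow := (tendsto_pow_const_div_const_pow_of_one_lt j hb).const_mul ((j : ℝ) + 1)
  have hone := tendsto_pow_const_div_const_pow_of_one_lt 0 hb
  simpa [add_div, mul_div_assoc] using hpow.add hone

theorem not_curseOfDimensionality_partialClass {D : ∀ d : ℕ, Set (E d)} {R : ℝ}
    (hD : ∀ᶠ d in atTop, UnitConvexDomain (D d) (R * √d)) {j k : ℕ} (hj : j ≤ k)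
    {L : ℕ → ℕ → ℝ} (hL : ∀ m ≤ j, ∀ d, 1 ≤ d → 0 ≤ L m d)
    (hlim : Tendsto (fun d : ℕ => L j d * (d : ℝ) ^ ((j : ℝ) + 1 / 2)) atTop (𝓝 0)) :
    ¬ CurseOfDimensionality D fun d => partialClass (D d) k fun j => L j d := by
  rintro ⟨c, ε, γ, hc, hε, hγ, hcurse⟩
  have hsmall : ∀ᶠ d : ℕ in atTop,
      R ^ (j + 1) * (L j d * (d : ℝ) ^ ((j : ℝ) + 1 / 2)) < ε / 3 :=
    (by simpa using hlim.const_mul (R ^ (j + 1)) : Tendsto _ _ _).eventually_lt_const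
      (by positivity)
  have hgrowth := (tendsto_poly_div_pow_atTop j (by linarith : 1 < 1 + γ)).eventually_lt_const hc
  obtain ⟨d, hcursed, hDd, hsmalld, hgrowthd, hd⟩ := ((hcurse ε hε le_rfl).and_eventually
    (hD.and (hsmall.and (hgrowth.and (eventually_ge_atTop 1))))).exists
  have hd0 : (0 : ℝ) < d := by exact_mod_cast hd
  have herror : (√d * (R * √d)) ^ j * (L j d * (R * √d)) =
      R ^ (j + 1) * (L j d * (d : ℝ) ^ ((j : ℝ) + 1 / 2)) := by
    rw [Real.rpow_add hd0, Real.rpow_natCast, ← Real.sqrt_eq_rpow, mul_left_comm √(d : ℝ),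
      Real.mul_self_sqrt hd0.le, mul_pow]
    ring
  have hle := infoComplexity_partialClass_le hd hDd (L := fun j => L j d) hj
    (fun m hm => hL m hm d hd) (B := ε / 3) (by positivity) (herror.trans_le hsmalld.le)
  rw [mul_div_cancel₀ _ (three_ne_zero' ℝ)] at hle
  have hpoly : c * (1 + γ) ^ d ≤ (j + 1) * (d : ℝ) ^ j + 1 := by
    have hcast := hcursed.trans (ENat.toENNReal_le.2 hle)
    rw [ENat.toENNReal_coe, ENNReal.ofReal_le_iff_le_toReal (ENNReal.natCast_ne_top _),
      ENNReal.toReal_natCast] at hcast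
    exact_mod_cast hcast
  exact ((div_lt_iff₀ (by positivity)).1 hgrowthd).not_ge hpoly

end CurseIntegration

end

theorem proposition5p4
    (D : ∀ d : ℕ, Set (CurseIntegration.E d))
    (hD : (∀ d, 1 ≤ d → D d = CurseIntegration.openCube d) ∨
      CurseIntegration.ConvexSmallRadius D)
    (k : ℕ) (hk : 1 ≤ k)
    (L : ℕ → ℕ → ℝ) (hL : ∀ j ≤ k, ∀ d, 1 ≤ d → 0 < L j d) :
    (0 < limsup (fun d : ℕ =>
          min ((L 0 d * Real.sqrt d : ℝ) : EReal)
            (⨅ j ∈ Finset.Icc 1 k, ((L j d * (d : ℝ) : ℝ) : EReal))) atTop →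
      CurseIntegration.CurseOfDimensionality D
        (fun d => CurseIntegration.partialClass (D d) k (fun j => L j d))) ∧
    ((∃ j ≤ k, Tendsto (fun d : ℕ => L j d * (d : ℝ) ^ ((j : ℝ) + 1 / 2)) atTop (𝓝 0)) →
      ¬ CurseIntegration.CurseOfDimensionality D
        (fun d => CurseIntegration.partialClass (D d) k (fun j => L j d))) := by
  obtain ⟨⟨R, hdomain⟩, hhull⟩ := CurseIntegration.exists_unitConvexDomain_and_smallHullNhds hD
  refine ⟨fun hlimsup => ?_, fun ⟨j, hj, hlim⟩ => ?_⟩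
  · obtain ⟨δ, hδ, hfreq⟩ := CurseIntegration.exists_frequently_of_limsup_pos hlimsup
    exact CurseIntegration.curseOfDimensionality_partialClass hdomain hhull hδ hfreq
  · exact CurseIntegration.not_curseOfDimensionality_partialClass hdomain hj
      (fun m hm d hd => (hL m (hm.trans hj) d hd).le) hlim
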